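/- Let $m,n\ge 0$, $d=m+n$, $D=\mathbb{R}_{\ge 0}^m\times\mathbb{R}^n$, and write $x=(x_I,x_J)$ for the partition of a $d$-vector into its first $m$ and last $n$ coordinates. For $u\in\mathbb{C}^d$ put $f_u(x)=e^{\langle x,u\rangle}$, $\langle x,u\rangle=\sum_i x_iu_i$, and let $$\mathcal U=\{u\in\mathbb{C}^d:\ \mathrm{Re}\,u_I\le 0,\ \mathrm{Re}\,u_J=0\}.$$ Let $(X_t,\mathbb{P}^x)_{t\ge 0,\,x\in D}$ be a (possibly killed) time-homogeneous Markov process with state space $D$, with $X_0=x$ $\mathbb{P}^x$-almost surely; when the process may be killed, it is sent to a cemetery state, adjoined to $D$ as an isolated point, at which every $f_u$ is set to $0$. Assume that: (a) $X$ is affine: there are functions $\Phi:\mathbb{R}_{\ge 0}\times i\mathbb{R}^d\to\mathbb{C}$ and $\psi:\mathbb{R}_{\ge 0}\times i\mathbb{R}^d\to\mathbb{C}^d$ with $$\mathbb{E}^x[f_u(X_t)]=\Phi(t,u)\,e^{\langle x,\psi(t,u)\rangle}\qquad(x\in D,\ (t,u)\in\mathbb{R}_{\ge 0}\times i\mathbb{R}^d);$$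 (b) $X$ is stochastically continuous: for all $x\in D$ and $s\ge 0$, $X_t\to X_s$ in $\mathbb{P}^x$-probability as $t\to s$; (c) $X$ is semi-homogeneous: for all $x\in D$ and $(t,u)\in\mathbb{R}_{\ge 0}\times i\mathbb{R}^d$, $$\mathbb{E}^x[f_u(X_t)]=e^{\langle x_J,u_J\rangle}\,\mathbb{E}^{(x_I,0)}[f_u(X_t)].$$ Then $X$ is regular. That is, with $$\mathcal Q=\{(t,u)\in\mathbb{R}_{\ge 0}\times\mathcal U:\ \mathbb{E}^0[f_u(X_t)]\ne 0\},$$ there exist (necessarily unique) continuous functions $\Phi:\mathcal Q\to\mathbb{C}$ and $\psi:\mathcal Q\to\mathbb{C}^d$ such that $\mathbb{E}^x[f_u(X_t)]=\Phi(t,u)\,e^{\langle x,\psi(t,u)\rangle}$ for all $x\in D$ and $(t,u)\in\mathcal Q$, and for every $u\in\mathcal U$ the right derivatives $$F(u)=\left.\frac{\partial}{\partial t}\Phi(t,u)\right|_{t=0},\qquad R(u)=\left.\frac{\partial}{\partial t}\psi(t,u)\right|_{t=0}$$ exist, and $F$ and $R$ are continuous functions on $\mathcal U$. -/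

import Mathlib

open MeasureTheory ProbabilityTheory Filter Topology Set
open scoped NNReal ENNReal

noncomputable section

namespace AffineProc

/-- The state space `D = ℝ_{≥0}^m × ℝ^n`; a point is `x = (x_I, x_J)`. -/
abbrev State (m n : ℕ) : Type := (Fin m → ℝ≥0) × (Fin n → ℝ)

/-- The space `ℂ^d = ℂ^m × ℂ^n`, `d = m + n`; a point is `u = (u_I, u_J)`. -/
abbrev CVec (m n : ℕ) : Type := (Fin m → ℂ) × (Fin n → ℂ)

/-- The state space together with a cemetery state `Sum.inr ()`, adjoined as an isolated point. -/
abbrev KilledState (m n : ℕ) : Type := State m n ⊕ Unit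

/-- The bilinear pairing `⟨x, u⟩ = ∑ᵢ xᵢ uᵢ`. -/
def pairing {m n : ℕ} (x : State m n) (u : CVec m n) : ℂ :=
  (∑ i, ((x.1 i : ℝ) : ℂ) * u.1 i) + ∑ j, (x.2 j : ℂ) * u.2 j

/-- The set `i ℝ^d` of purely imaginary vectors. -/
def imaginary (m n : ℕ) : Set (CVec m n) :=
  {u | (∀ i, (u.1 i).re = 0) ∧ ∀ j, (u.2 j).re = 0}

/-- The set `𝒰 = {u ∈ ℂ^d : Re u_I ≤ 0, Re u_J = 0}`. -/
def cU (m n : ℕ) : Set (CVec m n) :=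
  {u | (∀ i, (u.1 i).re ≤ 0) ∧ ∀ j, (u.2 j).re = 0}

/-- The exponential `f_u(x) = exp ⟨x, u⟩`, with value `0` at the cemetery. -/
def expFun {m n : ℕ} (u : CVec m n) : KilledState m n → ℂ
  | Sum.inl x => Complex.exp (pairing x u)
  | Sum.inr _ => 0

/-- A (possibly killed) time-homogeneous Markov process `(X_t, ℙ^x)`, `t ≥ 0`, `x ∈ D`, on a
filtered measurable space, with state space `D = ℝ_{≥0}^m × ℝ^n`. -/
structure MarkovProcess (m n : ℕ) (Ω : Type*) [mΩ : MeasurableSpace Ω] where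
  /-- the filtration `(ℱ_t)` -/
  filtration : Filtration ℝ≥0 mΩ
  /-- the process `(X_t)` -/
  X : ℝ≥0 → Ω → KilledState m n
  /-- the law `ℙ^x` of the process started at `x` -/
  P : State m n → Measure Ω
  isProbabilityMeasure : ∀ x, IsProbabilityMeasure (P x)
  adapted : ∀ t, Measurable[filtration t] (X t)
  initial : ∀ x, ∀ᵐ ω ∂(P x), X 0 ω = Sum.inl x
  /-- `x ↦ ℙ^x(X_t ∈ B)` is measurable -/
  measurable_law : ∀ (t : ℝ≥0) (B : Set (State m n)), MeasurableSet B →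
    Measurable fun x => P x (X t ⁻¹' (Sum.inl '' B))
  /-- the Markov property `ℙ^x(X_{s+t} ∈ B | ℱ_s) = ℙ^{X_s}(X_t ∈ B)`, where the right-hand side
  is `0` when `X_s` is the cemetery -/
  markov : ∀ (x : State m n) (s t : ℝ≥0) (B : Set (State m n)), MeasurableSet B →
    (P x)⟦X (s + t) ⁻¹' (Sum.inl '' B) | filtration s⟧ =ᵐ[P x] fun ω =>
      Sum.elim (fun y => (P y).real (X t ⁻¹' (Sum.inl '' B))) (fun _ => (0 : ℝ)) (X s ω)

namespace MarkovProcess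

variable {m n : ℕ} {Ω : Type*} [MeasurableSpace Ω]

/-- The expectation `𝔼^x[f_u(X_t)]`. -/
def charFun (X : MarkovProcess m n Ω) (x : State m n) (t : ℝ≥0) (u : CVec m n) : ℂ :=
  ∫ ω, expFun u (X.X t ω) ∂(X.P x)

/-- The affine property: on `ℝ_{≥0} × i ℝ^d` the characteristic function is exponentially affine
in the initial state. -/
def IsAffine (X : MarkovProcess m n Ω) : Prop :=
  ∃ (Φ : ℝ≥0 → CVec m n → ℂ) (ψ : ℝ≥0 → CVec m n → CVec m n),
    ∀ (x : State m n) (t : ℝ≥0), ∀ u ∈ imaginary m n,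
      X.charFun x t u = Φ t u * Complex.exp (pairing x (ψ t u))

end MarkovProcess

/-- Two points of the state space with cemetery are `ε`-close: both are the cemetery, or both lie
in `D` at distance less than `ε`. -/
def IsClose {m n : ℕ} (ε : ℝ) : KilledState m n → KilledState m n → Prop
  | Sum.inl x, Sum.inl y => dist x y < ε
  | Sum.inr _, Sum.inr _ => True
  | _, _ => False

namespace MarkovProcess

variable {m n : ℕ} {Ω : Type*} [MeasurableSpace Ω]

/-- Stochastic continuity: `X_t → X_s` in `ℙ^x`-probability as `t → s`, for all `x` and `s`. -/
def IsStochContinuous (X : MarkovProcess m n Ω) : Prop :=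
  ∀ (x : State m n) (s : ℝ≥0) (ε : ℝ), 0 < ε →
    Tendsto (fun t => X.P x {ω | ¬ IsClose ε (X.X t ω) (X.X s ω)}) (𝓝 s) (𝓝 0)

/-- Semi-homogeneity:
`𝔼^x[exp ⟨X_t, u⟩] = exp ⟨x_J, u_J⟩ * 𝔼^{(x_I, 0)}[exp ⟨X_t, u⟩]` on `ℝ_{≥0} × i ℝ^d`. -/
def IsSemiHomogeneous (X : MarkovProcess m n Ω) : Prop :=
  ∀ (x : State m n) (t : ℝ≥0), ∀ u ∈ imaginary m n,
    X.charFun x t u = Complex.exp (∑ j, (x.2 j : ℂ) * u.2 j) * X.charFun (x.1, 0) t u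

/-- The set `𝒬 = {(t, u) ∈ ℝ_{≥0} × 𝒰 : 𝔼^0[f_u(X_t)] ≠ 0}`. -/
def domQ (X : MarkovProcess m n Ω) : Set (ℝ≥0 × CVec m n) :=
  {q | q.2 ∈ cU m n ∧ X.charFun 0 q.1 q.2 ≠ 0}

/-- `Φ` and `ψ` are continuous on `𝒬` and satisfy the affine formula there. By
`IsAffineExtension.unique` below there is at most one such pair of functions on `𝒬`. -/
structure IsAffineExtension (X : MarkovProcess m n Ω) (Φ : ℝ≥0 × CVec m n → ℂ)
    (ψ : ℝ≥0 × CVec m n → CVec m n) : Prop where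
  continuousOn_Φ : ContinuousOn Φ X.domQ
  continuousOn_ψ : ContinuousOn ψ X.domQ
  affine : ∀ q ∈ X.domQ, ∀ x : State m n,
    X.charFun x q.1 q.2 = Φ q * Complex.exp (pairing x (ψ q))

/-- Regularity: the (unique) continuous extensions of `Φ` and `ψ` to `𝒬` exist, their right
derivatives `F(u) = ∂ₜ Φ(t, u)` and `R(u) = ∂ₜ ψ(t, u)` at `t = 0` exist for all `u ∈ 𝒰`, and `F`
and `R` are continuous on `𝒰`. -/
def IsRegular (X : MarkovProcess m n Ω) : Prop :=
  ∃ (Φ : ℝ≥0 × CVec m n → ℂ) (ψ : ℝ≥0 × CVec m n → CVec m n), X.IsAffineExtension Φ ψ ∧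
    ∃ (F : CVec m n → ℂ) (R : CVec m n → CVec m n),
      ContinuousOn F (cU m n) ∧ ContinuousOn R (cU m n) ∧
      ∀ u ∈ cU m n,
        HasDerivWithinAt (fun t : ℝ => Φ (t.toNNReal, u)) (F u) (Ici 0) 0 ∧
        HasDerivWithinAt (fun t : ℝ => ψ (t.toNNReal, u)) (R u) (Ici 0) 0

end MarkovProcess

theorem eq_of_exp_mul_eq {a b : ℂ}
    (h : ∀ r : ℝ≥0, Complex.exp (((r : ℝ) : ℂ) * a) = Complex.exp (((r : ℝ) : ℂ) * b)) :
    a = b := by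
  have key : ∀ c : ℂ, HasDerivWithinAt (fun r : ℝ => Complex.exp ((r : ℂ) * c)) c (Ici 0) 0 := by
    intro c
    have h1 : HasDerivAt (fun r : ℝ => (r : ℂ) * c) (1 * c) (0 : ℝ) :=
      (Complex.ofRealCLM.hasDerivAt (x := (0 : ℝ))).mul_const c
    have h2 := h1.cexp
    simpa using h2.hasDerivWithinAt (s := Ici (0 : ℝ))
  have hb := key b
  have ha : HasDerivWithinAt (fun r : ℝ => Complex.exp ((r : ℂ) * b)) a (Ici 0) 0 := by
    refine (key a).congr (fun r hr => ?_) ?_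
    · exact (h ⟨r, hr⟩).symm
    · simp
  exact (uniqueDiffWithinAt_Ici (0 : ℝ)).eq_deriv _ ha hb

theorem eq_of_exp_pairing_eq {m n : ℕ} {v w : CVec m n}
    (h : ∀ x : State m n, Complex.exp (pairing x v) = Complex.exp (pairing x w)) : v = w := by
  refine Prod.ext (funext fun i => ?_) (funext fun j => ?_)
  · refine eq_of_exp_mul_eq fun r => ?_
    have := h (Pi.single i r, 0)
    simpa [pairing, Pi.single_apply, apply_ite] using this
  · refine eq_of_exp_mul_eq fun r => ?_
    have := h (0, Pi.single j (r : ℝ))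
    simpa [pairing, Pi.single_apply, apply_ite] using this

theorem MarkovProcess.IsAffineExtension.unique {m n : ℕ} {Ω : Type*} [MeasurableSpace Ω]
    {X : MarkovProcess m n Ω} {Φ Φ' : ℝ≥0 × CVec m n → ℂ} {ψ ψ' : ℝ≥0 × CVec m n → CVec m n}
    (h : X.IsAffineExtension Φ ψ) (h' : X.IsAffineExtension Φ' ψ') :
    EqOn Φ Φ' X.domQ ∧ EqOn ψ ψ' X.domQ := by
  have h0 : ∀ v : CVec m n, pairing (0 : State m n) v = 0 := by intro v; simp [pairing]
  have hΦ : ∀ q ∈ X.domQ, X.charFun 0 q.1 q.2 = Φ q := by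
    intro q hq; simpa [h0] using h.affine q hq 0
  have hΦ' : ∀ q ∈ X.domQ, X.charFun 0 q.1 q.2 = Φ' q := by
    intro q hq; simpa [h0] using h'.affine q hq 0
  refine ⟨fun q hq => (hΦ q hq).symm.trans (hΦ' q hq), fun q hq => ?_⟩
  refine eq_of_exp_pairing_eq fun x => ?_
  have e := (h.affine q hq x).symm.trans (h'.affine q hq x)
  rw [← hΦ q hq, ← hΦ' q hq] at e
  exact mul_left_cancel₀ hq.2 e

end AffineProc

end

open MeasureTheory ProbabilityTheory Filter Topology Set
open scoped NNReal ENNReal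

noncomputable section

namespace AffineProc

/-! ### The pairing and bounds on the exponentials -/

variable {m n : ℕ}

/-! Write Φ(t,u) = E^0 f_u(X_t). For imaginary u the affine formula gives E^x f_u · E^y f_u = E^0
f_u · E^{x+y} f_u. Both sides are transforms of convolutions, so the identity persists on 𝒰. On 𝒬
the quotient E^x f_u / E^0 f_u is therefore multiplicative in x, and it is continuous by Lévy's
theorem, hence exponential (`exists_exponent`). This yields ψ, with ψ_J = u_J by semi-homogeneity.
The Markov property then makes ψ a local semiflow and Φ a multiplicative cocycle over it
(`charFun_zero_add`, `psi_add`).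

Differentiability at t = 0 is obtained first where Re u_I < 0. Since u_J does not move, Im u_J is a
mere parameter, and (w, u_I) ↦ (wΦ, ψ_I) is a holomorphic semiflow in finite dimension. By the
Schwarz lemma a holomorphic map close to the identity differs from it by a map of small Lipschitz
constant. So k steps of length t displace a point by almost k times one step, and the difference
quotient at t is close to the one at kt, where kt is close to a fixed s. The quotients therefore
converge, jointly in t and u, and the limits F and R_I are continuous
(`exists_tendsto_semiflow_slope`, `exists_tendsto_quotient`).

To reach the boundary of 𝒰, use that F(u) + ⟨x_I, R_I(u)⟩ is the limit of t⁻¹(E^x e^{⟨X_t - x, u⟩} -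
1). Since |e^u - e^v|² = e^{u+ū} - 2 Re e^{u+v̄} + e^{v+v̄}, such limits control the L² size of
differences of exponentials under t⁻¹ times the law. Convexity along -θ(1,…,1,0,…,0) gives a limit
of the real part as θ → 0, so the L² norm of e^{-δ} - e^{-(δ+ε)} is small. A Cauchy–Schwarz type
estimate then transfers the known continuity at points shifted into the interior to the boundary
point itself (`norm_second_difference_le`, `exists_tendsto_boundary`).

Finally, for small times ψ(t,·) preserves the interior (`eventually_psi_mem_interiorU`). There (Φ,
ψ_I) solves the Riccati equations with right-hand side (Φ F(ψ), R_I(ψ)), which is now continuous up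
to the boundary. The mean value inequality, uniform in interior u, passes to boundary points
(`hasDerivWithinAt_curve_boundary`). -/

@[simp] theorem pairing_zero_left (u : CVec m n) : pairing (0 : State m n) u = 0 := by
  simp [pairing]

theorem pairing_add_left (x y : State m n) (u : CVec m n) :
    pairing (x + y) u = pairing x u + pairing y u := by
  simp only [pairing, Prod.fst_add, Prod.snd_add, Pi.add_apply, NNReal.coe_add, Complex.ofReal_add,
    add_mul, Finset.sum_add_distrib]
  ring

theorem pairing_add_right (x : State m n) (u v : CVec m n) :
    pairing x (u + v) = pairing x u + pairing x v := by
  simp only [pairing, Prod.fst_add, Prod.snd_add, Pi.add_apply, mul_add, Finset.sum_add_distrib]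
  ring

theorem pairing_smul_right (x : State m n) (c : ℂ) (u : CVec m n) :
    pairing x (c • u) = c * pairing x u := by
  simp only [pairing, Prod.smul_fst, Prod.smul_snd, Pi.smul_apply, smul_eq_mul, mul_add,
    Finset.mul_sum]
  congr 1 <;> exact Finset.sum_congr rfl fun _ _ => by ring

theorem pairing_sub_right (x : State m n) (u v : CVec m n) :
    pairing x (u - v) = pairing x u - pairing x v := by
  rw [sub_eq_add_neg, ← neg_one_smul ℂ v, pairing_add_right, pairing_smul_right]
  ring

theorem re_pairing (x : State m n) (u : CVec m n) :
    (pairing x u).re = (∑ i, (x.1 i : ℝ) * (u.1 i).re) + ∑ j, x.2 j * (u.2 j).re := by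
  simp [pairing]

theorem re_pairing_nonpos (x : State m n) {u : CVec m n} (hu : u ∈ cU m n) :
    (pairing x u).re ≤ 0 := by
  rw [re_pairing]
  have h1 : ∑ i, (x.1 i : ℝ) * (u.1 i).re ≤ 0 :=
    Finset.sum_nonpos fun i _ => mul_nonpos_of_nonneg_of_nonpos (x.1 i).2 (hu.1 i)
  have h2 : ∑ j, x.2 j * (u.2 j).re = 0 := Finset.sum_eq_zero fun j _ => by rw [hu.2 j, mul_zero]
  linarith

theorem norm_exp_pairing_le_one (x : State m n) {u : CVec m n} (hu : u ∈ cU m n) :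
    ‖Complex.exp (pairing x u)‖ ≤ 1 := by
  rw [Complex.norm_exp]
  exact Real.exp_le_one_iff.2 (re_pairing_nonpos x hu)

@[fun_prop]
theorem continuous_pairing : Continuous fun p : State m n × CVec m n => pairing p.1 p.2 := by
  unfold pairing
  fun_prop

@[fun_prop]
theorem continuous_pairing_comp {T : Type*} [TopologicalSpace T] {f : T → State m n} {g : T → CVec m n}
    (hf : Continuous f) (hg : Continuous g) : Continuous fun t => pairing (f t) (g t) :=
  continuous_pairing.comp (hf.prodMk hg)

theorem imaginary_subset_cU : imaginary m n ⊆ cU m n := fun _ hu => ⟨fun i => (hu.1 i).le, hu.2⟩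

theorem norm_exp_sub_exp_le {a b : ℂ} (ha : a.re ≤ 0) (hb : b.re ≤ 0) :
    ‖Complex.exp a - Complex.exp b‖ ≤ ‖a - b‖ := by
  have h := Convex.norm_image_sub_le_of_norm_deriv_le (𝕜 := ℂ) (f := Complex.exp) (C := 1)
    (s := {z : ℂ | z.re ≤ 0}) (fun z _ => Complex.differentiableAt_exp) (fun z hz => by
      rw [Complex.deriv_exp, Complex.norm_exp]
      exact Real.exp_le_one_iff.2 hz) (convex_halfSpace_re_le 0) hb ha
  simpa using h

theorem norm_pairing_sub_le (x y : State m n) (u : CVec m n) :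
    ‖pairing x u - pairing y u‖ ≤ ((∑ i, ‖u.1 i‖) + ∑ j, ‖u.2 j‖) * dist x y := by
  have e : pairing x u - pairing y u = (∑ i, (((x.1 i : ℝ) - (y.1 i : ℝ) : ℝ) : ℂ) * u.1 i) +
      ∑ j, ((x.2 j - y.2 j : ℝ) : ℂ) * u.2 j := by
    simp only [pairing, Complex.ofReal_sub, sub_mul, Finset.sum_sub_distrib]
    ring
  rw [e, add_mul, Finset.sum_mul, Finset.sum_mul]
  refine (norm_add_le _ _).trans (add_le_add ?_ ?_)
  · refine (norm_sum_le _ _).trans (Finset.sum_le_sum fun i _ => ?_)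
    rw [norm_mul, mul_comm, Complex.norm_real]
    refine mul_le_mul_of_nonneg_left ?_ (norm_nonneg _)
    calc ‖(x.1 i : ℝ) - (y.1 i : ℝ)‖ = dist (x.1 i) (y.1 i) := rfl
      _ ≤ dist x.1 y.1 := dist_le_pi_dist _ _ _
      _ ≤ dist x y := le_max_left _ _
  · refine (norm_sum_le _ _).trans (Finset.sum_le_sum fun i _ => ?_)
    rw [norm_mul, mul_comm, Complex.norm_real]
    refine mul_le_mul_of_nonneg_left ?_ (norm_nonneg _)
    calc ‖x.2 i - y.2 i‖ = dist (x.2 i) (y.2 i) := rfl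
      _ ≤ dist x.2 y.2 := dist_le_pi_dist _ _ _
      _ ≤ dist x y := le_max_right _ _

theorem norm_expFun_le_one {u : CVec m n} (hu : u ∈ cU m n) (z : KilledState m n) :
    ‖expFun u z‖ ≤ 1 := by
  rcases z with x | x
  · exact norm_exp_pairing_le_one x hu
  · simp [expFun]

theorem norm_expFun_sub_le {u : CVec m n} (hu : u ∈ cU m n) {ε : ℝ}
    {z w : KilledState m n} (h : IsClose ε z w) (hε : 0 ≤ ε) :
    ‖expFun u z - expFun u w‖ ≤ ((∑ i, ‖u.1 i‖) + ∑ j, ‖u.2 j‖) * ε := by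
  rcases z with x | x <;> rcases w with y | y
  · refine (norm_exp_sub_exp_le (re_pairing_nonpos x hu) (re_pairing_nonpos y hu)).trans
      ((norm_pairing_sub_le x y u).trans (mul_le_mul_of_nonneg_left (le_of_lt h) (by positivity)))
  · exact h.elim
  · exact h.elim
  · simp only [expFun, sub_self, norm_zero]; positivity

theorem measurable_expFun (u : CVec m n) : Measurable (expFun u) := by
  refine measurable_fun_sum ?_ measurable_const
  exact (by fun_prop : Continuous fun x : State m n => Complex.exp (pairing x u)).measurable

theorem measurableEmbedding_inl {α β : Type*} [MeasurableSpace α] [MeasurableSpace β] :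
    MeasurableEmbedding (Sum.inl : α → α ⊕ β) :=
  ⟨Sum.inl_injective, measurable_inl, fun _ hs => hs.inl_image⟩

/-! ### Transition laws: joint continuity and the Chapman–Kolmogorov equation -/

namespace MarkovProcess

variable {Ω : Type*} [mΩ : MeasurableSpace Ω] (X : MarkovProcess m n Ω)

instance (x : State m n) : IsProbabilityMeasure (X.P x) := X.isProbabilityMeasure x

theorem measurable_X (t : ℝ≥0) : Measurable (X.X t) := (X.adapted t).mono (X.filtration.le t) le_rfl

/-- The law of `X_t` under `ℙ^x`, restricted to the event that the process is not killed. -/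
def law (t : ℝ≥0) (x : State m n) : Measure (State m n) :=
  ((X.P x).map (X.X t)).comap Sum.inl

theorem law_apply (t : ℝ≥0) (x : State m n) {B : Set (State m n)} (hB : MeasurableSet B) :
    X.law t x B = X.P x (X.X t ⁻¹' (Sum.inl '' B)) := by
  rw [law, measurableEmbedding_inl.comap_apply, Measure.map_apply (X.measurable_X t) hB.inl_image]

theorem law_univ_le_one (t : ℝ≥0) (x : State m n) : X.law t x univ ≤ 1 := by
  rw [X.law_apply t x MeasurableSet.univ]
  exact prob_le_one

instance isFiniteMeasure_law (t : ℝ≥0) (x : State m n) : IsFiniteMeasure (X.law t x) :=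
  ⟨(X.law_univ_le_one t x).trans_lt ENNReal.one_lt_top⟩

theorem integral_law {G : Type*} [NormedAddCommGroup G] [NormedSpace ℝ G] (t : ℝ≥0)
    (x : State m n) {f : State m n → G} (hf : StronglyMeasurable f) :
    ∫ y, f y ∂X.law t x = ∫ ω, Sum.elim f (fun _ => 0) (X.X t ω) ∂X.P x := by
  have hm : StronglyMeasurable (Sum.elim f (fun _ => 0) : KilledState m n → G) := by
    borelize G
    refine stronglyMeasurable_iff_measurable_separable.2
      ⟨hf.measurable.sumElim measurable_const, ?_⟩
    refine (hf.isSeparable_range.union (finite_singleton (0 : G)).isSeparable).mono ?_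
    rintro _ ⟨z | z, rfl⟩
    · exact Or.inl ⟨z, rfl⟩
    · exact Or.inr rfl
  rw [← integral_map_of_stronglyMeasurable (X.measurable_X t) hm, law]
  have h := (measurableEmbedding_inl (α := State m n) (β := Unit)).integral_map
    (μ := ((X.P x).map (X.X t)).comap Sum.inl) (Sum.elim f (fun _ => 0))
  rw [measurableEmbedding_inl.map_comap,
    setIntegral_eq_integral_of_forall_compl_eq_zero] at h
  · exact h.symm
  · rintro (z | z) hz
    · exact (hz ⟨z, rfl⟩).elim
    · rfl

theorem charFun_eq (x : State m n) (t : ℝ≥0) (u : CVec m n) :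
    X.charFun x t u = ∫ y, Complex.exp (pairing y u) ∂X.law t x := by
  rw [X.integral_law, charFun]
  · congr with ω
    rcases X.X t ω with y | y <;> rfl
  · exact (by fun_prop : Continuous fun y : State m n => Complex.exp (pairing y u)).stronglyMeasurable

theorem integrable_exp_pairing (x : State m n) (t : ℝ≥0) {u : CVec m n} (hu : u ∈ cU m n) :
    Integrable (fun y => Complex.exp (pairing y u)) (X.law t x) :=
  Integrable.of_bound (C := 1)
    (by fun_prop : Continuous fun y : State m n => Complex.exp (pairing y u)).aestronglyMeasurable
    (Eventually.of_forall fun y => norm_exp_pairing_le_one y hu)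

theorem norm_charFun_le_one (x : State m n) (t : ℝ≥0) {u : CVec m n} (hu : u ∈ cU m n) :
    ‖X.charFun x t u‖ ≤ 1 := by
  have h := norm_integral_le_of_norm_le_const (μ := X.P x) (C := 1)
    (Eventually.of_forall fun ω => norm_expFun_le_one hu (X.X t ω))
  simpa [charFun] using h

theorem charFun_zero (x : State m n) (u : CVec m n) :
    X.charFun x 0 u = Complex.exp (pairing x u) := by
  have : ∀ᵐ ω ∂X.P x, expFun u (X.X 0 ω) = Complex.exp (pairing x u) := by
    filter_upwards [X.initial x] with ω h
    rw [h]; rfl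
  rw [charFun, integral_congr_ae this]
  simp

/-- Dominated convergence handles u at a fixed time. The change of time is uniform for u in bounded
sets, because f_u is Lipschitz with a constant governed by the size of u and is bounded by 1. -/
theorem continuousOn_charFun (hS : X.IsStochContinuous) (x : State m n) :
    ContinuousOn (fun q : ℝ≥0 × CVec m n => X.charFun x q.1 q.2) {q | q.2 ∈ cU m n} := by
  rintro ⟨s, u₀⟩ hu₀
  have hmeas : ∀ (t : ℝ≥0) (u : CVec m n),
      AEStronglyMeasurable (fun ω => expFun u (X.X t ω)) (X.P x) := fun t u =>
    ((measurable_expFun u).comp (X.measurable_X t)).aestronglyMeasurable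
  have hint : ∀ (t : ℝ≥0) {u : CVec m n}, u ∈ cU m n →
      Integrable (fun ω => expFun u (X.X t ω)) (X.P x) := fun t u hu =>
    Integrable.of_bound (C := 1) (hmeas t u) (Eventually.of_forall fun ω => norm_expFun_le_one hu _)
  set l := 𝓝[{q : ℝ≥0 × CVec m n | q.2 ∈ cU m n}] (s, u₀) with hl
  have hmem : ∀ᶠ q in l, q.2 ∈ cU m n := self_mem_nhdsWithin
  have hl1 : Tendsto (fun q : ℝ≥0 × CVec m n => q.1) l (𝓝 s) :=
    (continuous_fst.tendsto (s, u₀)).mono_left nhdsWithin_le_nhds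
  have hl2 : Tendsto (fun q : ℝ≥0 × CVec m n => q.2) l (𝓝 u₀) :=
    (continuous_snd.tendsto (s, u₀)).mono_left nhdsWithin_le_nhds
  have hsnd : Tendsto (fun q : ℝ≥0 × CVec m n => X.charFun x s q.2) l (𝓝 (X.charFun x s u₀)) := by
    refine tendsto_integral_filter_of_dominated_convergence (fun _ => 1)
      (Eventually.of_forall fun q => hmeas s q.2) ?_ (integrable_const _) ?_
    · filter_upwards [hmem] with q hq
      exact Eventually.of_forall fun ω => norm_expFun_le_one hq _
    · refine Eventually.of_forall fun ω => ?_
      rcases X.X s ω with y | y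
      · exact ((by fun_prop : Continuous fun u : CVec m n =>
          Complex.exp (pairing y u)).tendsto u₀).comp hl2
      · exact tendsto_const_nhds
  have hfst : Tendsto (fun q : ℝ≥0 × CVec m n => X.charFun x q.1 q.2 - X.charFun x s q.2) l
      (𝓝 0) := by
    set K : CVec m n → ℝ := fun u => (∑ i, ‖u.1 i‖) + ∑ j, ‖u.2 j‖ with hK
    have hKc : Tendsto (fun q : ℝ≥0 × CVec m n => K q.2) l (𝓝 (K u₀)) :=
      ((by fun_prop : Continuous K).tendsto u₀).comp hl2
    have hK0 : ∀ u, 0 ≤ K u := fun u => by positivity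
    rw [Metric.tendsto_nhds]
    intro η hη
    -- Here ε makes the Lipschitz part less than η/2. Off the close event the integrand is at most 2
    -- and the probability is below η/4, which accounts for the other η/2.
    obtain ⟨ε, hε, hεη⟩ : ∃ ε : ℝ, 0 < ε ∧ (K u₀ + 1) * ε < η / 2 := by
      refine ⟨η / 4 / (K u₀ + 1), by have := hK0 u₀; positivity, ?_⟩
      rw [mul_div_cancel₀ _ (by have := hK0 u₀; positivity)]
      linarith
    have hP := (ENNReal.tendsto_toReal ENNReal.zero_ne_top).comp ((hS x s ε hε).comp hl1)
    rw [ENNReal.toReal_zero] at hP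
    filter_upwards [hmem, hKc.eventually (gt_mem_nhds (lt_add_one (K u₀))),
      hP.eventually (gt_mem_nhds (by positivity : 0 < η / 4))] with q hq hKq hPq
    simp only [Function.comp_apply] at hPq
    rw [dist_zero_right, charFun, charFun, ← integral_sub (hint q.1 hq) (hint s hq)]
    set S := {ω | ¬ IsClose ε (X.X q.1 ω) (X.X s ω)} with hSdef
    -- The measurable hull has the same probability, so measurability of the exceptional event need
    -- not be checked.
    set S' := toMeasurable (X.P x) S with hS'
    have hS'm : MeasurableSet S' := measurableSet_toMeasurable _ _
    have hbound : ∀ ω, ‖expFun q.2 (X.X q.1 ω) - expFun q.2 (X.X s ω)‖ ≤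
        K q.2 * ε + S'.indicator (fun _ => (2 : ℝ)) ω := by
      intro ω
      have hKε : 0 ≤ K q.2 * ε := mul_nonneg (hK0 _) hε.le
      by_cases h : IsClose ε (X.X q.1 ω) (X.X s ω)
      · refine (norm_expFun_sub_le hq h hε.le).trans ?_
        exact le_add_of_nonneg_right (indicator_nonneg (fun _ _ => zero_le_two) _)
      · have hω : ω ∈ S' := subset_toMeasurable _ _ h
        rw [indicator_of_mem hω]
        refine (norm_sub_le _ _).trans ?_
        linarith [norm_expFun_le_one hq (X.X q.1 ω), norm_expFun_le_one hq (X.X s ω)]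
    calc ‖∫ ω, (expFun q.2 (X.X q.1 ω) - expFun q.2 (X.X s ω)) ∂X.P x‖
        ≤ ∫ ω, (K q.2 * ε + S'.indicator (fun _ => (2 : ℝ)) ω) ∂X.P x :=
          norm_integral_le_of_norm_le ((integrable_const _).add
            ((integrable_const _).indicator hS'm)) (Eventually.of_forall hbound)
      _ = K q.2 * ε + (X.P x S).toReal * 2 := by
          rw [integral_add (integrable_const _) ((integrable_const _).indicator hS'm),
            integral_indicator hS'm, setIntegral_const]
          simp [hS', measureReal_def, measure_toMeasurable]
      _ < η := by nlinarith
  have := hfst.add hsnd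
  simpa [ContinuousWithinAt] using this

/-- The transition kernel of the process at time `t`. -/
def kernel (t : ℝ≥0) : Kernel (State m n) (State m n) where
  toFun := X.law t
  measurable' := Measure.measurable_of_measurable_coe _ fun B hB => by
    simp only [X.law_apply t _ hB]
    exact X.measurable_law t B hB

instance (t : ℝ≥0) : IsFiniteKernel (X.kernel t) :=
  ⟨1, ENNReal.one_lt_top, fun x => X.law_univ_le_one t x⟩

/-- Chapman–Kolmogorov, from integrating the Markov property; the cemetery contributes 0 on both
sides. -/
theorem law_add (s t : ℝ≥0) (x : State m n) :
    X.law (s + t) x = (X.kernel t ∘ₖ X.kernel s) x := by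
  ext B hB
  have hpre : MeasurableSet (X.X (s + t) ⁻¹' (Sum.inl '' B)) :=
    X.measurable_X _ hB.inl_image
  have h1 : (X.P x).real (X.X (s + t) ⁻¹' (Sum.inl '' B)) =
      ∫ y, (X.law t y).real B ∂X.law s x := by
    have hf : StronglyMeasurable fun y => (X.law t y).real B :=
      ((X.kernel t).measurable_coe hB).ennreal_toReal.stronglyMeasurable
    rw [X.integral_law s x hf]
    have h := integral_congr_ae (X.markov x s t B hB)
    rw [integral_condExp (X.filtration.le s), integral_indicator hpre, setIntegral_const,
      smul_eq_mul, mul_one] at h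
    rw [h]
    congr with ω
    rcases X.X s ω with y | y
    · simp only [Sum.elim_inl, measureReal_def, X.law_apply t y hB]
    · rfl
  rw [Kernel.comp_apply' _ _ _ hB, X.law_apply _ _ hB]
  have h2 : ∫ y, (X.law t y).real B ∂X.law s x = (∫⁻ y, X.law t y B ∂X.law s x).toReal :=
    integral_toReal ((X.kernel t).measurable_coe hB).aemeasurable
      (Eventually.of_forall fun y => measure_lt_top _ _)
  rw [h2, measureReal_def, ENNReal.toReal_eq_toReal_iff' (measure_ne_top _ _)] at h1
  · exact h1
  · refine ((lintegral_mono fun y => (measure_mono (subset_univ B)).trans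
      (X.law_univ_le_one t y)).trans_lt ?_).ne
    simp

theorem charFun_add (s t : ℝ≥0) (x : State m n) {u : CVec m n} (hu : u ∈ cU m n) :
    X.charFun x (s + t) u = ∫ y, X.charFun y t u ∂X.law s x := by
  rw [X.charFun_eq, X.law_add]
  have h := X.integrable_exp_pairing x (s + t) hu
  rw [X.law_add] at h
  rw [Kernel.integral_comp h]
  simp_rw [X.charFun_eq]
  rfl

end MarkovProcess

/-- The embedding of the state space into Euclidean space. -/
def toEuclid {m n : ℕ} (x : State m n) : EuclideanSpace ℝ (Fin m ⊕ Fin n) :=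
  WithLp.toLp 2 (Sum.elim (fun i => (x.1 i : ℝ)) x.2)

/-- A continuous left inverse of `toEuclid`. -/
def ofEuclid {m n : ℕ} (y : EuclideanSpace ℝ (Fin m ⊕ Fin n)) : State m n :=
  (fun i => (y (Sum.inl i)).toNNReal, fun j => y (Sum.inr j))

/-- The purely imaginary vector `i v`. -/
def imagVec {m n : ℕ} (v : EuclideanSpace ℝ (Fin m ⊕ Fin n)) : CVec m n :=
  (fun i => v (Sum.inl i) * Complex.I, fun j => v (Sum.inr j) * Complex.I)

/-! ### Passing from imaginary arguments to 𝒰 -/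

section Fourier

variable {m n : ℕ}

theorem ofEuclid_toEuclid (x : State m n) : ofEuclid (toEuclid x) = x := by
  simp [ofEuclid, toEuclid]

theorem continuous_toEuclid : Continuous (toEuclid : State m n → _) := by
  refine (PiLp.continuous_toLp 2 _).comp (continuous_pi fun k => ?_)
  rcases k with i | j
  · simp only [Sum.elim_inl]; fun_prop
  · simp only [Sum.elim_inr]; fun_prop

theorem continuous_ofEuclid : Continuous (ofEuclid : _ → State m n) := by
  unfold ofEuclid
  refine Continuous.prodMk (continuous_pi fun i => ?_) (continuous_pi fun j => ?_)
  · exact continuous_real_toNNReal.comp (by fun_prop)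
  · fun_prop

theorem imagVec_mem (v : EuclideanSpace ℝ (Fin m ⊕ Fin n)) : imagVec v ∈ imaginary m n := by
  simp [imagVec, imaginary]

theorem inner_toEuclid (x : State m n) (v : EuclideanSpace ℝ (Fin m ⊕ Fin n)) :
    ((inner ℝ (toEuclid x) v : ℝ) : ℂ) * Complex.I = pairing x (imagVec v) := by
  simp only [PiLp.inner_apply, pairing, toEuclid, imagVec, Fintype.sum_sum_type, Sum.elim_inl,
    Sum.elim_inr, RCLike.inner_apply, conj_trivial, Complex.ofReal_add, Complex.ofReal_sum,
    Complex.ofReal_mul, add_mul, Finset.sum_mul]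
  congr 1 <;> exact Finset.sum_congr rfl fun _ _ => by ring

theorem charFun_map_toEuclid (μ : Measure (State m n)) (v : EuclideanSpace ℝ (Fin m ⊕ Fin n)) :
    charFun (μ.map toEuclid) v = ∫ x, Complex.exp (pairing x (imagVec v)) ∂μ := by
  rw [charFun_apply, integral_map continuous_toEuclid.aemeasurable
    (by fun_prop : Continuous fun x : EuclideanSpace ℝ (Fin m ⊕ Fin n) =>
      Complex.exp (inner ℝ x v * Complex.I)).aestronglyMeasurable]
  simp_rw [inner_toEuclid]

theorem map_ofEuclid_map_toEuclid (μ : Measure (State m n)) :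
    (μ.map toEuclid).map ofEuclid = μ := by
  rw [Measure.map_map continuous_ofEuclid.measurable continuous_toEuclid.measurable]
  convert Measure.map_id
  funext x
  exact ofEuclid_toEuclid x

/-- A finite measure on the state space is determined by its Fourier transform. -/
theorem measure_ext_of_integral_exp_pairing {μ ν : Measure (State m n)} [IsFiniteMeasure μ]
    [IsFiniteMeasure ν] (h : ∀ u ∈ imaginary m n,
      ∫ x, Complex.exp (pairing x u) ∂μ = ∫ x, Complex.exp (pairing x u) ∂ν) : μ = ν := by
  rw [← map_ofEuclid_map_toEuclid μ, ← map_ofEuclid_map_toEuclid ν]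
  congr 1
  refine Measure.ext_of_charFun (funext fun v => ?_)
  rw [charFun_map_toEuclid, charFun_map_toEuclid]
  exact h _ (imagVec_mem v)

theorem integrable_exp_pairing_of_mem_cU {μ : Measure (State m n)} [IsFiniteMeasure μ]
    {u : CVec m n} (hu : u ∈ cU m n) : Integrable (fun x => Complex.exp (pairing x u)) μ :=
  Integrable.of_bound (C := 1)
    (by fun_prop : Continuous fun y : State m n => Complex.exp (pairing y u)).aestronglyMeasurable
    (Eventually.of_forall fun y => norm_exp_pairing_le_one y hu)

theorem integral_exp_pairing_conv (μ ν : Measure (State m n)) [IsFiniteMeasure μ]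
    [IsFiniteMeasure ν] {u : CVec m n} (hu : u ∈ cU m n) :
    ∫ x, Complex.exp (pairing x u) ∂(μ.conv ν) =
      (∫ x, Complex.exp (pairing x u) ∂μ) * ∫ x, Complex.exp (pairing x u) ∂ν := by
  rw [integral_conv (integrable_exp_pairing_of_mem_cU hu)]
  simp_rw [pairing_add_left, Complex.exp_add, integral_const_mul, integral_mul_const]

/-- A product identity between Laplace transforms extends from imaginary arguments to `𝒰`. -/
theorem integral_exp_pairing_mul_eq_of_imaginary {μ₁ μ₂ ν₁ ν₂ : Measure (State m n)}
    [IsFiniteMeasure μ₁] [IsFiniteMeasure μ₂] [IsFiniteMeasure ν₁] [IsFiniteMeasure ν₂]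
    (h : ∀ u ∈ imaginary m n,
      (∫ x, Complex.exp (pairing x u) ∂μ₁) * ∫ x, Complex.exp (pairing x u) ∂μ₂ =
        (∫ x, Complex.exp (pairing x u) ∂ν₁) * ∫ x, Complex.exp (pairing x u) ∂ν₂)
    {u : CVec m n} (hu : u ∈ cU m n) :
    (∫ x, Complex.exp (pairing x u) ∂μ₁) * ∫ x, Complex.exp (pairing x u) ∂μ₂ =
        (∫ x, Complex.exp (pairing x u) ∂ν₁) * ∫ x, Complex.exp (pairing x u) ∂ν₂ := by
  -- The two products are transforms of convolutions, and equality at imaginary arguments already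
  -- identifies these as measures.
  have key : μ₁.conv μ₂ = ν₁.conv ν₂ := by
    refine measure_ext_of_integral_exp_pairing fun v hv => ?_
    rw [integral_exp_pairing_conv _ _ (imaginary_subset_cU hv),
      integral_exp_pairing_conv _ _ (imaginary_subset_cU hv), h v hv]
  rw [← integral_exp_pairing_conv _ _ hu, key, integral_exp_pairing_conv _ _ hu]

/-- Lévy's theorem beyond probability measures, as killing loses mass: the value at 0 gives
convergence of the masses, after which one normalizes. -/
theorem tendsto_finiteMeasure_of_tendsto_charFun {E : Type*} [NormedAddCommGroup E]
    [InnerProductSpace ℝ E] [FiniteDimensional ℝ E] [MeasurableSpace E] [BorelSpace E]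
    {μ : ℕ → FiniteMeasure E} {μ₀ : FiniteMeasure E}
    (h : ∀ t : E, Tendsto (fun k => charFun (μ k : Measure E) t) atTop
      (𝓝 (charFun (μ₀ : Measure E) t))) : Tendsto μ atTop (𝓝 μ₀) := by
  have hmass : Tendsto (fun k => (μ k).mass) atTop (𝓝 μ₀.mass) := by
    have h0 := h 0
    simp only [charFun_zero] at h0
    have h1 := (Complex.continuous_re.tendsto _).comp h0
    have e : ∀ ρ : FiniteMeasure E, (((ρ : Measure E).real univ : ℂ)).re = (ρ.mass : ℝ) :=
      fun ρ => rfl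
    simp only [Function.comp_def, e] at h1
    exact_mod_cast h1
  -- A zero limit cannot be normalized, but then convergence of the masses alone suffices.
  rcases eq_or_ne μ₀ 0 with h0 | h0
  · subst h0
    refine FiniteMeasure.tendsto_zero_of_tendsto_zero_mass ?_
    simpa using hmass
  · have hm0 : μ₀.mass ≠ 0 := μ₀.mass_nonzero_iff.2 h0
    have key : ∀ (ρ : FiniteMeasure E), ρ.mass ≠ 0 → ∀ t,
        charFun (ρ.normalize : Measure E) t = ((ρ.mass⁻¹ : ℝ≥0) : ℂ) * charFun (ρ : Measure E) t := by
      intro ρ hρ t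
      rw [ρ.toMeasure_normalize_eq_of_nonzero (ρ.mass_nonzero_iff.1 hρ), charFun_apply,
        charFun_apply, integral_smul_nnreal_measure]
      rw [NNReal.smul_def, Complex.real_smul]
    refine FiniteMeasure.tendsto_of_tendsto_normalize_testAgainstNN_of_tendsto_mass ?_ hmass
    refine ProbabilityMeasure.tendsto_of_tendsto_charFun fun t => ?_
    rw [key μ₀ hm0]
    have hc : Tendsto (fun k => (((μ k).mass⁻¹ : ℝ≥0) : ℂ) * charFun (μ k : Measure E) t) atTop
        (𝓝 (((μ₀.mass⁻¹ : ℝ≥0) : ℂ) * charFun (μ₀ : Measure E) t)) := by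
      refine Tendsto.mul ?_ (h t)
      have h2 : Tendsto (fun k => (μ k).mass⁻¹) atTop (𝓝 μ₀.mass⁻¹) := hmass.inv₀ hm0
      exact (Complex.continuous_ofReal.tendsto _).comp
        ((NNReal.continuous_coe.tendsto _).comp h2)
    refine hc.congr' ?_
    filter_upwards [hmass.eventually_ne hm0] with k hk
    rw [key _ hk]

/-- Convergence of Laplace transforms of finite measures extends from imaginary arguments to
`𝒰`. -/
theorem tendsto_integral_exp_pairing_of_imaginary {μ : ℕ → Measure (State m n)}
    {μ₀ : Measure (State m n)} [∀ k, IsFiniteMeasure (μ k)] [IsFiniteMeasure μ₀]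
    (h : ∀ u ∈ imaginary m n, Tendsto (fun k => ∫ x, Complex.exp (pairing x u) ∂μ k) atTop
      (𝓝 (∫ x, Complex.exp (pairing x u) ∂μ₀))) {u : CVec m n} (hu : u ∈ cU m n) :
    Tendsto (fun k => ∫ x, Complex.exp (pairing x u) ∂μ k) atTop
      (𝓝 (∫ x, Complex.exp (pairing x u) ∂μ₀)) := by
  let ν : ℕ → FiniteMeasure (EuclideanSpace ℝ (Fin m ⊕ Fin n)) :=
    fun k => ⟨(μ k).map toEuclid, inferInstance⟩
  let ν₀ : FiniteMeasure (EuclideanSpace ℝ (Fin m ⊕ Fin n)) := ⟨μ₀.map toEuclid, inferInstance⟩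
  have hν : Tendsto ν atTop (𝓝 ν₀) := by
    refine tendsto_finiteMeasure_of_tendsto_charFun fun t => ?_
    simp only [ν, ν₀, FiniteMeasure.toMeasure_mk, charFun_map_toEuclid]
    exact h _ (imagVec_mem t)
  have hcont : Continuous fun y : EuclideanSpace ℝ (Fin m ⊕ Fin n) =>
      Complex.exp (pairing (ofEuclid y) u) :=
    Complex.continuous_exp.comp (continuous_pairing_comp continuous_ofEuclid continuous_const)
  -- Composing with `ofEuclid`, which always lands in D, keeps the exponential bounded on the whole
  -- Euclidean space.
  let g : BoundedContinuousFunction (EuclideanSpace ℝ (Fin m ⊕ Fin n)) ℂ :=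
    BoundedContinuousFunction.ofNormedAddCommGroup _ hcont 1
      fun y => norm_exp_pairing_le_one _ hu
  have e : ∀ ρ : Measure (State m n), ∫ y, g y ∂(ρ.map toEuclid) =
      ∫ x, Complex.exp (pairing x u) ∂ρ := by
    intro ρ
    rw [integral_map continuous_toEuclid.aemeasurable g.continuous.aestronglyMeasurable]
    refine integral_congr_ae (Eventually.of_forall fun x => ?_)
    simp [g, ofEuclid_toEuclid]
  have := (FiniteMeasure.tendsto_iff_forall_integral_rclike_tendsto ℂ).1 hν g
  simpa only [ν, ν₀, FiniteMeasure.toMeasure_mk, e] using this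

end Fourier

/-! ### Affine and semi-homogeneous identities on 𝒰 -/

namespace MarkovProcess

variable {m n : ℕ} {Ω : Type*} [MeasurableSpace Ω] {X : MarkovProcess m n Ω}

/-- This product form of the affine property involves no ψ, so it extends to 𝒰 before any exponent
is known there. -/
theorem charFun_mul_charFun (hA : X.IsAffine) (x y : State m n) (t : ℝ≥0) {u : CVec m n}
    (hu : u ∈ cU m n) :
    X.charFun x t u * X.charFun y t u = X.charFun 0 t u * X.charFun (x + y) t u := by
  obtain ⟨Φ, ψ, h⟩ := hA
  simp only [X.charFun_eq]
  refine integral_exp_pairing_mul_eq_of_imaginary (fun v hv => ?_) hu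
  simp only [← X.charFun_eq, h _ t v hv, pairing_add_left, Complex.exp_add, pairing_zero_left,
    Complex.exp_zero]
  ring

/-- The factor e^{⟨x_J, u_J⟩} is the transform of the Dirac mass at (0, x_J), so semi-homogeneity is
also a product identity. -/
theorem charFun_eq_exp_mul (hH : X.IsSemiHomogeneous) (x : State m n) (t : ℝ≥0) {u : CVec m n}
    (hu : u ∈ cU m n) :
    X.charFun x t u = Complex.exp (∑ j, (x.2 j : ℂ) * u.2 j) * X.charFun (x.1, 0) t u := by
  have hd : ∀ (z : State m n) (v : CVec m n),
      ∫ y, Complex.exp (pairing y v) ∂(Measure.dirac z) = Complex.exp (pairing z v) := fun z v =>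
    integral_dirac _ _
  have hp : ∀ v : CVec m n, pairing ((0, x.2) : State m n) v = ∑ j, (x.2 j : ℂ) * v.2 j :=
    fun v => by simp [pairing]
  have h := integral_exp_pairing_mul_eq_of_imaginary (μ₁ := Measure.dirac (0 : State m n))
    (μ₂ := X.law t x) (ν₁ := Measure.dirac ((0, x.2) : State m n)) (ν₂ := X.law t (x.1, 0))
    (fun v hv => by
      simp only [← X.charFun_eq, hd, hp, pairing_zero_left, Complex.exp_zero, one_mul]
      exact hH x t v hv) hu
  simpa only [← X.charFun_eq, hd, hp, pairing_zero_left, Complex.exp_zero, one_mul] using h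

/-- At imaginary arguments continuity can be read off the affine formula; Lévy's theorem carries it
to 𝒰. -/
theorem continuous_charFun_initial (hA : X.IsAffine) (t : ℝ≥0) {u : CVec m n} (hu : u ∈ cU m n) :
    Continuous fun x : State m n => X.charFun x t u := by
  obtain ⟨Φ, ψ, h⟩ := hA
  refine continuous_iff_seqContinuous.2 fun x x₀ hx => ?_
  simp only [Function.comp_def, X.charFun_eq]
  refine tendsto_integral_exp_pairing_of_imaginary (fun v hv => ?_) hu
  simp only [← X.charFun_eq, h _ t v hv]
  exact ((by fun_prop : Continuous fun z : State m n =>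
    Φ t v * Complex.exp (pairing z (ψ t v))).tendsto x₀).comp hx

end MarkovProcess

/-! ### Exponentials in one variable -/

section Exponential

/-- The primitive of γ has nonzero derivative at 0. The bound ε ≤ 1 serves a later domination. -/
theorem exists_integral_ne_zero {γ : ℝ → ℂ} (hγ : Continuous γ) (h0 : γ 0 ≠ 0) :
    ∃ ε : ℝ, 0 < ε ∧ ε ≤ 1 ∧ ∫ r in (0 : ℝ)..ε, γ r ≠ 0 := by
  have hd : HasDerivAt (fun x => ∫ r in (0 : ℝ)..x, γ r) (γ 0) 0 :=
    intervalIntegral.integral_hasDerivAt_right (hγ.intervalIntegrable _ _)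
      (hγ.stronglyMeasurableAtFilter _ _) hγ.continuousAt
  have h1 : ∀ᶠ x in 𝓝[>] (0 : ℝ), ∫ r in (0 : ℝ)..x, γ r ≠ 0 :=
    (hd.eventually_ne h0).filter_mono (nhdsWithin_mono _ fun x hx => ne_of_gt hx)
  obtain ⟨ε, hε, hε1⟩ := (h1.and (Ioc_mem_nhdsGT (zero_lt_one' ℝ))).exists
  exact ⟨ε, hε1.1, hε1.2, hε⟩

/-- A continuous multiplicative function on `[0, ∞)` is an exponential. -/
theorem exists_eq_exp_of_mul {g : ℝ≥0 → ℂ} (hg : Continuous g) (h0 : g 0 = 1)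
    (hmul : ∀ r s, g (r + s) = g r * g s) : ∃ a : ℂ, ∀ r : ℝ≥0, g r = Complex.exp ((r : ℝ) * a) := by
  set γ : ℝ → ℂ := fun r => g r.toNNReal with hγdef
  have hγ : Continuous γ := hg.comp continuous_real_toNNReal
  have hγ0 : γ 0 = 1 := by simp [hγdef, h0]
  have hγmul : ∀ r s, 0 ≤ r → 0 ≤ s → γ (r + s) = γ r * γ s := fun r s hr hs => by
    simp only [hγdef, Real.toNNReal_add hr hs, hmul]
  obtain ⟨ε, hε, -, hc⟩ := exists_integral_ne_zero hγ (by rw [hγ0]; exact one_ne_zero)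
  set c := ∫ r in (0 : ℝ)..ε, γ r with hcdef
  set a := (γ ε - 1) / c with ha
  -- Multiplicativity writes γ as a moving average of itself, which upgrades continuity to right
  -- differentiability with γ' = aγ.
  have hH : ∀ x, 0 ≤ x → γ x = c⁻¹ * ∫ r in x..(x + ε), γ r := by
    intro x hx
    have e : ∫ r in x..(x + ε), γ r = γ x * c := by
      rw [hcdef, ← intervalIntegral.integral_const_mul]
      have := intervalIntegral.integral_comp_add_left (a := 0) (b := ε) γ x
      rw [add_zero] at this
      rw [← this]
      refine intervalIntegral.integral_congr fun r hr => ?_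
      rw [uIcc_of_le hε.le] at hr
      exact hγmul x r hx hr.1
    rw [e]
    field_simp
  have hder : ∀ x, 0 ≤ x → HasDerivWithinAt γ (a * γ x) (Ici x) x := by
    intro x hx
    have hF : ∀ y, HasDerivAt (fun x => ∫ r in (0 : ℝ)..x, γ r) (γ y) y := fun y =>
      intervalIntegral.integral_hasDerivAt_right (hγ.intervalIntegrable _ _)
        (hγ.stronglyMeasurableAtFilter _ _) hγ.continuousAt
    have h1 : HasDerivAt (fun x => c⁻¹ * ((∫ r in (0 : ℝ)..(x + ε), γ r) -
        ∫ r in (0 : ℝ)..x, γ r)) (c⁻¹ * (γ (x + ε) - γ x)) x :=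
      (((hF (x + ε)).comp_add_const x ε).sub (hF x)).const_mul _
    have h2 : c⁻¹ * (γ (x + ε) - γ x) = a * γ x := by
      rw [hγmul x ε hx hε.le, ha]; ring
    rw [h2] at h1
    refine h1.hasDerivWithinAt.congr (fun y hy => ?_) ?_
    · rw [hH y (hx.trans hy), intervalIntegral.integral_interval_sub_left
        (hγ.intervalIntegrable _ _) (hγ.intervalIntegrable _ _)]
    · rw [hH x hx, intervalIntegral.integral_interval_sub_left
        (hγ.intervalIntegrable _ _) (hγ.intervalIntegrable _ _)]
  refine ⟨a, fun r => ?_⟩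
  have hE : ∀ x : ℝ, HasDerivAt (fun x : ℝ => Complex.exp (-(x * a))) (Complex.exp (-(x * a)) * -a) x := by
    intro x
    have := ((Complex.ofRealCLM.hasDerivAt (x := x)).mul_const a).neg.cexp
    simpa using this
  have hconst := constant_of_has_deriv_right_zero (f := fun x : ℝ => γ x * Complex.exp (-(x * a)))
    (a := 0) (b := r) (by fun_prop) (fun x hx => by
      have := (hder x hx.1).mul (hE x).hasDerivWithinAt
      rw [show a * γ x * Complex.exp (-(x * a)) + γ x * (Complex.exp (-(x * a)) * -a) = 0 by
        ring] at this
      exact this) r ⟨r.2, le_rfl⟩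
  simp only [hγ0, Complex.ofReal_zero, zero_mul, neg_zero, Complex.exp_zero, mul_one] at hconst
  have hr : γ r = g r := by simp [hγdef]
  rw [hr, Complex.exp_neg, mul_inv_eq_one₀ (Complex.exp_ne_zero _)] at hconst
  exact hconst

/-- It recovers a from the exponentials e^{ra} without choosing a logarithm. -/
theorem mul_integral_exp (a : ℂ) (ε : ℝ) :
    a * ∫ r in (0 : ℝ)..ε, Complex.exp (r * a) = Complex.exp (ε * a) - 1 := by
  rcases eq_or_ne a 0 with rfl | ha
  · simp
  · simp_rw [mul_comm _ a]
    rw [integral_exp_mul_complex ha]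
    simp only [Complex.ofReal_zero, mul_zero, Complex.exp_zero]
    field_simp

/-- Convergence of all exponentials `e^{ra}`, `r ≥ 0`, implies convergence of the exponents. -/
theorem tendsto_of_tendsto_exp_mul {T : Type*} {l : Filter T} [l.IsCountablyGenerated]
    {a : T → ℂ} {a₀ : ℂ} (h : ∀ r : ℝ≥0, Tendsto (fun q => Complex.exp ((r : ℝ) * a q)) l
      (𝓝 (Complex.exp ((r : ℝ) * a₀)))) : Tendsto a l (𝓝 a₀) := by
  obtain ⟨ε, hε, hε1, hI⟩ := exists_integral_ne_zero
    (γ := fun r : ℝ => Complex.exp (r * a₀)) (by fun_prop) (Complex.exp_ne_zero _)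
  have hb : ∀ᶠ q in l, ‖Complex.exp (a q)‖ ≤ ‖Complex.exp a₀‖ + 1 := by
    have h1 := (h 1).norm
    simp only [NNReal.coe_one, Complex.ofReal_one, one_mul] at h1
    filter_upwards [h1.eventually (gt_mem_nhds (lt_add_one _))] with q hq using hq.le
  have hint : Tendsto (fun q => ∫ r in (0 : ℝ)..ε, Complex.exp (r * a q)) l
      (𝓝 (∫ r in (0 : ℝ)..ε, Complex.exp (r * a₀))) := by
    refine intervalIntegral.tendsto_integral_filter_of_dominated_convergence
      (fun _ => ‖Complex.exp a₀‖ + 1) ?_ ?_ intervalIntegrable_const ?_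
    · exact Eventually.of_forall fun q =>
        (by fun_prop : Continuous fun r : ℝ => Complex.exp (r * a q)).aestronglyMeasurable
    · filter_upwards [hb] with q hq
      refine Eventually.of_forall fun r hr => ?_
      rw [uIoc_of_le hε.le] at hr
      -- For 0 ≤ r ≤ 1 the modulus of e^{ra} is at most 1 or at most that of e^a, according to the
      -- sign of Re a.
      have hr1 : r ≤ 1 := hr.2.trans hε1
      rw [Complex.norm_exp, Complex.re_ofReal_mul]
      rw [Complex.norm_exp] at hq
      rcases le_total (a q).re 0 with h0 | h0
      · have : Real.exp (r * (a q).re) ≤ 1 :=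
          Real.exp_le_one_iff.2 (mul_nonpos_of_nonneg_of_nonpos hr.1.le h0)
        linarith [norm_nonneg (Complex.exp a₀)]
      · refine (Real.exp_le_exp.2 ?_).trans hq
        nlinarith
    · refine Eventually.of_forall fun r hr => ?_
      rw [uIoc_of_le hε.le] at hr
      exact h ⟨r, hr.1.le⟩
  have hq : Tendsto (fun q => (Complex.exp (ε * a q) - 1) /
      ∫ r in (0 : ℝ)..ε, Complex.exp (r * a q)) l (𝓝 ((Complex.exp (ε * a₀) - 1) /
      ∫ r in (0 : ℝ)..ε, Complex.exp (r * a₀))) :=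
    ((h ⟨ε, hε.le⟩).sub_const 1).div hint hI
  rw [← mul_integral_exp, mul_div_cancel_right₀ _ hI] at hq
  refine hq.congr' ?_
  filter_upwards [hint.eventually_ne hI] with q hq
  rw [← mul_integral_exp, mul_div_cancel_right₀ _ hq]

end Exponential

/-! ### The exponent ψ and its semiflow property -/

namespace MarkovProcess

variable {m n : ℕ} {Ω : Type*} [MeasurableSpace Ω] {X : MarkovProcess m n Ω}

/-- The unit vector `e_i`, scaled by `r ≥ 0`, in the state space. -/
def _root_.AffineProc.single {m n : ℕ} (i : Fin m) (r : ℝ≥0) : State m n := (Pi.single i r, 0)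

theorem pairing_single (i : Fin m) (r : ℝ≥0) (u : CVec m n) :
    pairing (single i r : State m n) u = (r : ℝ) * u.1 i := by
  simp [pairing, single, Pi.single_apply, apply_ite]

theorem continuous_state_single (i : Fin m) : Continuous fun r => (single i r : State m n) :=
  (continuous_single (A := fun _ : Fin m => ℝ≥0) i).prodMk continuous_const

theorem single_add (i : Fin m) (r s : ℝ≥0) :
    (single i (r + s) : State m n) = single i r + single i s := by
  simp [single, Pi.single_add]

theorem single_zero (i : Fin m) : (single i 0 : State m n) = 0 := by simp [single]

theorem eq_sum_single (x : State m n) : (x.1, 0) = ∑ i, (single i (x.1 i) : State m n) := by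
  refine Prod.ext ?_ ?_
  · simp only [Prod.fst_sum, single]
    exact (Finset.univ_sum_single x.1).symm
  · simp [Prod.snd_sum, single]

/-- After division by E^0 f_u the dependence on x is multiplicative. Each I-axis then carries a
continuous multiplicative function, hence an exponential, and semi-homogeneity supplies the J-part.
-/
theorem exists_exponent (hA : X.IsAffine) (hH : X.IsSemiHomogeneous) {q : ℝ≥0 × CVec m n}
    (hq : q ∈ X.domQ) : ∃ v : CVec m n, v.2 = q.2.2 ∧
      ∀ x, X.charFun x q.1 q.2 = X.charFun 0 q.1 q.2 * Complex.exp (pairing x v) := by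
  obtain ⟨hu, hne⟩ := hq
  set G : State m n → ℂ := fun x => X.charFun x q.1 q.2 / X.charFun 0 q.1 q.2 with hG
  have hG0 : G 0 = 1 := div_self hne
  have hGadd : ∀ x y, G (x + y) = G x * G y := by
    intro x y
    have := charFun_mul_charFun hA x y q.1 hu
    simp only [hG]
    field_simp
    linear_combination -this
  have hGc : Continuous G := (continuous_charFun_initial hA q.1 hu).div_const _
  have hex : ∀ i : Fin m, ∃ a : ℂ, ∀ r : ℝ≥0, G (single i r) = Complex.exp ((r : ℝ) * a) := by
    intro i
    refine exists_eq_exp_of_mul (hGc.comp (continuous_state_single i)) ?_ fun r s => ?_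
    · rw [single_zero, hG0]
    · rw [single_add, hGadd]
  choose a ha using hex
  refine ⟨(a, q.2.2), rfl, fun x => ?_⟩
  let f : Multiplicative (State m n) →* ℂ :=
    { toFun := fun x => G x.toAdd
      map_one' := hG0
      map_mul' := fun x y => hGadd _ _ }
  have hI : G (x.1, 0) = Complex.exp (∑ i, ((x.1 i : ℝ) : ℂ) * a i) := by
    rw [eq_sum_single, Complex.exp_sum]
    have := map_prod f (fun i => Multiplicative.ofAdd (single i (x.1 i) : State m n)) Finset.univ
    rw [← ofAdd_sum] at this
    simp only [f, MonoidHom.coe_mk, OneHom.coe_mk, toAdd_ofAdd, ha] at this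
    exact this
  rw [charFun_eq_exp_mul hH x q.1 hu]
  have : X.charFun (x.1, 0) q.1 q.2 = X.charFun 0 q.1 q.2 * G (x.1, 0) := by
    simp only [hG]; field_simp
  rw [this, hI]
  simp only [pairing, Complex.exp_add]
  ring

variable (X) in
/-- The exponent `ψ(t, u)`. -/
def psi (q : ℝ≥0 × CVec m n) : CVec m n :=
  Classical.epsilon fun v => v.2 = q.2.2 ∧
    ∀ x, X.charFun x q.1 q.2 = X.charFun 0 q.1 q.2 * Complex.exp (pairing x v)

theorem psi_snd (hA : X.IsAffine) (hH : X.IsSemiHomogeneous) {q : ℝ≥0 × CVec m n}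
    (hq : q ∈ X.domQ) : (X.psi q).2 = q.2.2 :=
  (Classical.epsilon_spec (exists_exponent hA hH hq)).1

theorem charFun_eq_mul_exp (hA : X.IsAffine) (hH : X.IsSemiHomogeneous) {q : ℝ≥0 × CVec m n}
    (hq : q ∈ X.domQ) (x : State m n) :
    X.charFun x q.1 q.2 = X.charFun 0 q.1 q.2 * Complex.exp (pairing x (X.psi q)) :=
  (Classical.epsilon_spec (exists_exponent hA hH hq)).2 x

theorem domQ_subset : X.domQ ⊆ {q | q.2 ∈ cU m n} := fun _ hq => hq.1

/-- The functions e^{rψ_i} are ratios of continuous expectations for every r ≥ 0, and this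
determines the limit of ψ_i without a branch of the logarithm. -/
theorem continuousOn_psi (hA : X.IsAffine) (hS : X.IsStochContinuous) (hH : X.IsSemiHomogeneous) :
    ContinuousOn X.psi X.domQ := by
  intro q₀ hq₀
  have h1 : Tendsto (fun q => (X.psi q).1) (𝓝[X.domQ] q₀) (𝓝 (X.psi q₀).1) := by
    refine tendsto_pi_nhds.2 fun i => tendsto_of_tendsto_exp_mul fun r => ?_
    have hc : ∀ x, Tendsto (fun q => X.charFun x q.1 q.2) (𝓝[X.domQ] q₀)
        (𝓝 (X.charFun x q₀.1 q₀.2)) := fun x =>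
      ((X.continuousOn_charFun hS x).mono domQ_subset) q₀ hq₀
    have hd := (hc (single i r)).div (hc 0) hq₀.2
    have e : ∀ q ∈ X.domQ, X.charFun (single i r) q.1 q.2 / X.charFun 0 q.1 q.2 =
        Complex.exp ((r : ℝ) * (X.psi q).1 i) := by
      intro q hq
      rw [charFun_eq_mul_exp hA hH hq, mul_div_cancel_left₀ _ hq.2, pairing_single]
    rw [e q₀ hq₀] at hd
    exact hd.congr' (by filter_upwards [self_mem_nhdsWithin] with q hq using e q hq)
  have h2 : Tendsto (fun q => (X.psi q).2) (𝓝[X.domQ] q₀) (𝓝 (X.psi q₀).2) := by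
    rw [psi_snd hA hH hq₀]
    refine Tendsto.congr' ?_ (((continuous_snd.comp continuous_snd).tendsto q₀).mono_left
      nhdsWithin_le_nhds)
    filter_upwards [self_mem_nhdsWithin] with q hq
    exact (psi_snd hA hH hq).symm
  exact h1.prodMk_nhds h2

theorem isAffineExtension_psi (hA : X.IsAffine) (hS : X.IsStochContinuous)
    (hH : X.IsSemiHomogeneous) :
    X.IsAffineExtension (fun q => X.charFun 0 q.1 q.2) X.psi where
  continuousOn_Φ := (X.continuousOn_charFun hS 0).mono domQ_subset
  continuousOn_ψ := continuousOn_psi hA hS hH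
  affine := fun _ hq x => charFun_eq_mul_exp hA hH hq x

theorem zero_mem_domQ {u : CVec m n} (hu : u ∈ cU m n) : ((0 : ℝ≥0), u) ∈ X.domQ := by
  refine ⟨hu, ?_⟩
  rw [X.charFun_zero, pairing_zero_left, Complex.exp_zero]
  exact one_ne_zero

theorem psi_zero (hA : X.IsAffine) (hH : X.IsSemiHomogeneous) {u : CVec m n} (hu : u ∈ cU m n) :
    X.psi (0, u) = u := by
  refine eq_of_exp_pairing_eq fun x => ?_
  have h := charFun_eq_mul_exp hA hH (zero_mem_domQ (X := X) hu) x
  simp only [X.charFun_zero, pairing_zero_left, Complex.exp_zero, one_mul] at h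
  exact h.symm

/-- A positive Re ψ_i would make the expectation from r e_i unbounded in r, whereas it is at most 1
in modulus. -/
theorem psi_mem_cU (hA : X.IsAffine) (hH : X.IsSemiHomogeneous) {q : ℝ≥0 × CVec m n}
    (hq : q ∈ X.domQ) : X.psi q ∈ cU m n := by
  refine ⟨fun i => ?_, fun j => by rw [psi_snd hA hH hq]; exact hq.1.2 j⟩
  by_contra! hpos
  have hb : ∀ r : ℝ≥0, ‖X.charFun 0 q.1 q.2‖ * Real.exp (r * ((X.psi q).1 i).re) ≤ 1 := by
    intro r
    have h := X.norm_charFun_le_one (single i r) q.1 hq.1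
    rwa [charFun_eq_mul_exp hA hH hq, norm_mul, pairing_single, Complex.norm_exp,
      Complex.re_ofReal_mul] at h
  have hne : 0 < ‖X.charFun 0 q.1 q.2‖ := norm_pos_iff.2 hq.2
  set A := ‖X.charFun 0 q.1 q.2‖
  -- With this r the exponent is A⁻¹, and A e^{A⁻¹} > A(1 + A⁻¹) = A + 1 > 1.
  have h : A * Real.exp (A⁻¹ / ((X.psi q).1 i).re * ((X.psi q).1 i).re) ≤ 1 :=
    hb ⟨A⁻¹ / ((X.psi q).1 i).re, by positivity⟩
  rw [div_mul_cancel₀ _ hpos.ne'] at h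
  have h2 := Real.add_one_lt_exp (inv_pos.2 hne).ne'
  have h3 : A * (A⁻¹ + 1) < A * Real.exp A⁻¹ := mul_lt_mul_of_pos_left h2 hne
  rw [mul_add, mul_inv_cancel₀ hne.ne'] at h3
  linarith

/-- In Chapman–Kolmogorov the inner expectation over time t is Φ(t,u) f_{ψ(t,u)}, which is then
averaged over time s. -/
theorem charFun_zero_add (hA : X.IsAffine) (hH : X.IsSemiHomogeneous) {t : ℝ≥0} {u : CVec m n}
    (hq : (t, u) ∈ X.domQ) (s : ℝ≥0) (x : State m n) :
    X.charFun x (t + s) u = X.charFun 0 t u * X.charFun x s (X.psi (t, u)) := by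
  rw [add_comm, X.charFun_add s t x hq.1, X.charFun_eq x s, ← integral_const_mul]
  exact integral_congr_ae (Eventually.of_forall fun y => charFun_eq_mul_exp hA hH hq y)

theorem psi_mem_domQ (hA : X.IsAffine) (hH : X.IsSemiHomogeneous) {t s : ℝ≥0} {u : CVec m n}
    (hq : (t, u) ∈ X.domQ) (hq' : (t + s, u) ∈ X.domQ) : (s, X.psi (t, u)) ∈ X.domQ := by
  refine ⟨psi_mem_cU hA hH hq, fun h0 => hq'.2 ?_⟩
  rw [charFun_zero_add hA hH hq, h0, mul_zero]

theorem psi_add (hA : X.IsAffine) (hH : X.IsSemiHomogeneous) {t s : ℝ≥0} {u : CVec m n}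
    (hq : (t, u) ∈ X.domQ) (hq' : (t + s, u) ∈ X.domQ) :
    X.psi (t + s, u) = X.psi (s, X.psi (t, u)) := by
  refine eq_of_exp_pairing_eq fun x => ?_
  have h := charFun_eq_mul_exp hA hH hq' x
  rw [charFun_zero_add hA hH hq, charFun_zero_add hA hH hq,
    charFun_eq_mul_exp hA hH (psi_mem_domQ hA hH hq hq') x, ← mul_assoc] at h
  have hne := hq'.2
  simp only at hne
  rw [charFun_zero_add hA hH hq] at hne
  exact (mul_left_cancel₀ hne h).symm

end MarkovProcess

/-- The set `{u ∈ 𝒰 : Re u_I < 0}`. -/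
def interiorU (m n : ℕ) : Set (CVec m n) :=
  {u | (∀ i, (u.1 i).re < 0) ∧ ∀ j, (u.2 j).re = 0}

/-- The real vector `-θ (1, …, 1, 0, …, 0)`. -/
def negOnes {m n : ℕ} (θ : ℝ) : CVec m n := (fun _ => ((-θ : ℝ) : ℂ), 0)

/-! ### The interior of 𝒰 and its invariance for small times -/

section

variable {m n : ℕ}

theorem interiorU_subset : interiorU m n ⊆ cU m n := fun _ hu => ⟨fun i => (hu.1 i).le, hu.2⟩

theorem negOnes_mem_interiorU {θ : ℝ} (hθ : 0 < θ) : (negOnes θ : CVec m n) ∈ interiorU m n :=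
  ⟨fun i => by simpa [negOnes] using hθ, fun j => by simp [negOnes]⟩

theorem negOnes_mem_cU {θ : ℝ} (hθ : 0 ≤ θ) : (negOnes θ : CVec m n) ∈ cU m n :=
  ⟨fun i => by simpa [negOnes] using hθ, fun j => by simp [negOnes]⟩

theorem add_mem_interiorU {u v : CVec m n} (hu : u ∈ cU m n) (hv : v ∈ interiorU m n) :
    u + v ∈ interiorU m n := by
  refine ⟨fun i => ?_, fun j => ?_⟩
  · simp only [Prod.fst_add, Pi.add_apply, Complex.add_re]
    linarith [hu.1 i, hv.1 i]
  · simp only [Prod.snd_add, Pi.add_apply, Complex.add_re]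
    linarith [hu.2 j, hv.2 j]

theorem exists_le_neg {u : CVec m n} (hu : u ∈ interiorU m n) :
    ∃ θ : ℝ, 0 < θ ∧ θ ≤ 1 ∧ ∀ i, (u.1 i).re ≤ -θ := by
  have h : ∀ i, ∀ᶠ θ in 𝓝[>] (0 : ℝ), (u.1 i).re ≤ -θ := fun i => by
    have : ∀ᶠ θ in 𝓝 (0 : ℝ), θ < -(u.1 i).re := gt_mem_nhds (by linarith [hu.1 i])
    filter_upwards [this.filter_mono nhdsWithin_le_nhds] with θ hθ
    linarith
  obtain ⟨θ, hθ, h1⟩ := ((eventually_all.2 h).and (Ioc_mem_nhdsGT (zero_lt_one' ℝ))).exists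
  exact ⟨θ, h1.1, h1.2, hθ⟩

theorem norm_expFun_le_rpow {u : CVec m n} (hu : u ∈ interiorU m n) {θ : ℝ} (hθ : 0 < θ)
    (h : ∀ i, (u.1 i).re ≤ -θ) (z : KilledState m n) :
    ‖expFun u z‖ ≤ ‖expFun (negOnes 1) z‖ ^ θ := by
  rcases z with x | x
  · simp only [expFun, Complex.norm_exp, ← Real.exp_mul]
    refine Real.exp_le_exp.2 ?_
    rw [re_pairing, re_pairing]
    simp only [hu.2, negOnes, Pi.zero_apply, Complex.zero_re, mul_zero, Finset.sum_const_zero,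
      add_zero, Complex.ofReal_re, Finset.sum_mul]
    refine Finset.sum_le_sum fun i _ => ?_
    have := mul_le_mul_of_nonneg_left (h i) (x.1 i).coe_nonneg
    linarith
  · simp [expFun, Real.zero_rpow hθ.ne']

end

namespace MarkovProcess

variable {m n : ℕ} {Ω : Type*} [MeasurableSpace Ω] {X : MarkovProcess m n Ω}

theorem domQ_mem_nhdsWithin (hS : X.IsStochContinuous) {q : ℝ≥0 × CVec m n} (hq : q ∈ X.domQ) :
    X.domQ ∈ 𝓝[{q | q.2 ∈ cU m n}] q := by
  have h := (X.continuousOn_charFun hS 0 q hq.1).eventually_ne hq.2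
  filter_upwards [h, self_mem_nhdsWithin] with p hp hp' using ⟨hp', hp⟩

/-- Jensen's inequality for the concave power θ ≤ 1. It compares every interior u with the single
vector `negOnes 1`. -/
theorem norm_charFun_le_rpow (x : State m n) (t : ℝ≥0) {u : CVec m n} (hu : u ∈ interiorU m n)
    {θ : ℝ} (hθ : 0 < θ) (hθ1 : θ ≤ 1) (h : ∀ i, (u.1 i).re ≤ -θ) :
    ‖X.charFun x t u‖ ≤ ‖X.charFun x t (negOnes 1)‖ ^ θ := by
  have hv : (negOnes 1 : CVec m n) ∈ cU m n := negOnes_mem_cU zero_le_one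
  have hm : Measurable fun ω => ‖expFun (negOnes 1) (X.X t ω)‖ :=
    ((measurable_expFun _).comp (X.measurable_X t)).norm
  have hb : ∀ ω, ‖expFun (negOnes 1) (X.X t ω)‖ ≤ 1 := fun ω => norm_expFun_le_one hv _
  have hint : Integrable (fun ω => ‖expFun (negOnes 1) (X.X t ω)‖) (X.P x) :=
    Integrable.of_bound (C := 1) hm.aestronglyMeasurable
      (Eventually.of_forall fun ω => by rw [norm_norm]; exact hb ω)
  have hint' : Integrable (fun ω => ‖expFun (negOnes 1) (X.X t ω)‖ ^ θ) (X.P x) :=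
    Integrable.of_bound (C := 1) (hm.pow_const θ).aestronglyMeasurable
      (Eventually.of_forall fun ω => by
        rw [Real.norm_of_nonneg (by positivity)]
        exact Real.rpow_le_one (norm_nonneg _) (hb ω) hθ.le)
  have e : ‖X.charFun x t (negOnes 1)‖ = ∫ ω, ‖expFun (negOnes 1) (X.X t ω)‖ ∂X.P x := by
    have : ∀ z : KilledState m n, expFun (negOnes 1) z = ((‖expFun (negOnes 1) z‖ : ℝ) : ℂ) := by
      rintro (y | y)
      · have : pairing y (negOnes 1) = (((pairing y (negOnes 1)).re : ℝ) : ℂ) := by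
          rw [re_pairing]
          simp [pairing, negOnes]
        simp only [expFun, Complex.norm_exp]
        rw [Complex.ofReal_exp, ← this]
      · simp [expFun]
    rw [charFun, funext fun ω => this (X.X t ω), integral_complex_ofReal, Complex.norm_real, Real.norm_of_nonneg
      (integral_nonneg fun _ => norm_nonneg _)]
  rw [e]
  refine ((norm_integral_le_integral_norm _).trans ?_).trans
    ((Real.concaveOn_rpow hθ.le hθ1).le_map_integral
      (Real.continuous_rpow_const hθ.le).continuousOn isClosed_Ici
      (Eventually.of_forall fun ω => norm_nonneg _) hint hint')
  exact integral_mono_of_nonneg (Eventually.of_forall fun _ => norm_nonneg _) hint'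
    (Eventually.of_forall fun ω => norm_expFun_le_rpow hu hθ h _)

/-- For small times, `ψ(t, ·)` maps the interior of `𝒰` into itself. -/
theorem eventually_psi_mem_interiorU (hA : X.IsAffine) (hS : X.IsStochContinuous)
    (hH : X.IsSemiHomogeneous) :
    ∀ᶠ t in 𝓝 (0 : ℝ≥0), ∀ u ∈ interiorU m n, (t, u) ∈ X.domQ → X.psi (t, u) ∈ interiorU m n := by
  have hv : (negOnes 1 : CVec m n) ∈ cU m n := negOnes_mem_cU zero_le_one
  have hQ0 := zero_mem_domQ (X := X) hv
  have hline : Tendsto (fun t : ℝ≥0 => (t, (negOnes 1 : CVec m n))) (𝓝 0)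
      (𝓝[{q | q.2 ∈ cU m n}] (0, negOnes 1)) :=
    tendsto_nhdsWithin_iff.2 ⟨(by fun_prop : Continuous fun t : ℝ≥0 =>
      (t, (negOnes 1 : CVec m n))).tendsto 0, Eventually.of_forall fun _ => hv⟩
  have hQ : ∀ᶠ t in 𝓝 (0 : ℝ≥0), (t, (negOnes 1 : CVec m n)) ∈ X.domQ :=
    hline.eventually (domQ_mem_nhdsWithin hS hQ0)
  have hψ : Tendsto (fun t : ℝ≥0 => X.psi (t, negOnes 1)) (𝓝 0) (𝓝 (negOnes 1)) := by
    have h := (continuousOn_psi hA hS hH _ hQ0).tendsto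
    rw [psi_zero hA hH hv] at h
    exact h.comp (tendsto_nhdsWithin_iff.2 ⟨hline.mono_right nhdsWithin_le_nhds, hQ⟩)
  -- The range of admissible times is fixed by `negOnes 1` alone, which makes it uniform over all
  -- interior u.
  have hneg : ∀ᶠ t in 𝓝 (0 : ℝ≥0), ∀ i, ((X.psi (t, negOnes 1)).1 i).re < 0 := by
    refine eventually_all.2 fun i => ?_
    have h1 : Tendsto (fun t : ℝ≥0 => ((X.psi (t, negOnes 1)).1 i).re) (𝓝 0)
        (𝓝 (((negOnes 1 : CVec m n).1 i).re)) :=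
      ((by fun_prop : Continuous fun w : CVec m n => (w.1 i).re).tendsto _).comp hψ
    exact h1.eventually (gt_mem_nhds ((negOnes_mem_interiorU zero_lt_one).1 i))
  filter_upwards [hQ, hneg] with t htQ htneg u hu huQ
  obtain ⟨θ, hθ, hθ1, hθu⟩ := exists_le_neg hu
  refine ⟨fun i => ?_, (psi_mem_cU hA hH huQ).2⟩
  by_contra! hge
  -- Starting from r e_i, the left side would not decay if Re ψ_i(t,u) ≥ 0, while the right side
  -- tends to 0 as r → ∞. This would force Φ(t,u) = 0.
  have hb : ∀ r : ℝ≥0, ‖X.charFun 0 t u‖ ≤ (‖X.charFun 0 t (negOnes 1)‖ *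
      Real.exp (r * ((X.psi (t, negOnes 1)).1 i).re)) ^ θ := by
    intro r
    have h := norm_charFun_le_rpow (X := X) (single i r) t hu hθ hθ1 hθu
    rw [charFun_eq_mul_exp hA hH huQ, charFun_eq_mul_exp hA hH htQ, norm_mul, norm_mul,
      pairing_single, pairing_single, Complex.norm_exp, Complex.norm_exp,
      Complex.re_ofReal_mul, Complex.re_ofReal_mul] at h
    refine le_trans ?_ h
    exact le_mul_of_one_le_right (norm_nonneg _) (Real.one_le_exp (mul_nonneg r.2 hge))
  have hlim : Tendsto (fun r : ℝ≥0 => (‖X.charFun 0 t (negOnes 1)‖ *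
      Real.exp (r * ((X.psi (t, negOnes 1)).1 i).re)) ^ θ) atTop (𝓝 0) := by
    have h1 : Tendsto (fun r : ℝ≥0 => (r : ℝ) * ((X.psi (t, negOnes 1)).1 i).re) atTop atBot :=
      Tendsto.atTop_mul_const_of_neg (htneg i) (NNReal.tendsto_coe_atTop.2 tendsto_id)
    have h2 := (Real.tendsto_exp_atBot.comp h1).const_mul ‖X.charFun 0 t (negOnes 1)‖
    rw [mul_zero] at h2
    have h3 := h2.rpow_const (p := θ) (Or.inr hθ.le)
    rwa [Real.zero_rpow hθ.ne'] at h3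
  have := ge_of_tendsto hlim (Eventually.of_forall hb)
  exact huQ.2 (norm_le_zero_iff.1 this)

end MarkovProcess

/-! ### Holomorphy in u_I -/

section Holomorphy

/-- By continuity f(w) - f(a) has imaginary part in (-π, π) near a, so the principal logarithm
recovers it. -/
theorem differentiableAt_of_differentiableAt_exp {E : Type*} [NormedAddCommGroup E]
    [NormedSpace ℂ E] {f : E → ℂ} {a : E} (hc : ContinuousAt f a)
    (hd : DifferentiableAt ℂ (fun w => Complex.exp (f w)) a) : DifferentiableAt ℂ f a := by
  have hd' : DifferentiableAt ℂ
      (fun w => f a + Complex.log (Complex.exp (f w) * (Complex.exp (f a))⁻¹)) a := by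
    refine (DifferentiableAt.clog (hd.mul_const _) ?_).const_add _
    rw [mul_inv_cancel₀ (Complex.exp_ne_zero _)]
    exact Complex.one_mem_slitPlane
  refine hd'.congr_of_eventuallyEq ?_
  have him : Tendsto (fun w => |(f w - f a).im|) (𝓝 a) (𝓝 0) := by
    have h1 : Tendsto (fun w => f w - f a) (𝓝 a) (𝓝 0) := by
      simpa using hc.tendsto.sub_const (f a)
    have h2 := ((continuous_abs.comp Complex.continuous_im).tendsto 0).comp h1
    simpa [Function.comp_def] using h2
  filter_upwards [him.eventually (gt_mem_nhds Real.pi_pos)] with w hw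
  rw [abs_lt] at hw
  rw [← div_eq_mul_inv, ← Complex.exp_sub, Complex.log_exp hw.1 hw.2.le]
  ring

end Holomorphy

namespace MarkovProcess

variable {m n : ℕ} {Ω : Type*} [MeasurableSpace Ω] {X : MarkovProcess m n Ω}

/-- Differentiation under the integral: with S the sum of the I-coordinates, the derivative is
dominated by S e^{-θS/2} ≤ 2/θ on a ball that keeps half the margin θ. -/
theorem differentiableAt_charFun (x : State m n) (t : ℝ≥0) {u : CVec m n}
    (hu : u ∈ interiorU m n) :
    DifferentiableAt ℂ (fun w : Fin m → ℂ => X.charFun x t (w, u.2)) u.1 := by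
  obtain ⟨θ, hθ, -, hθu⟩ := exists_le_neg hu
  have hball : ∀ w ∈ Metric.ball u.1 (θ / 2), ∀ i, (w i).re ≤ -(θ / 2) := by
    intro w hw i
    have h1 : ‖w i - u.1 i‖ < θ / 2 :=
      (norm_le_pi_norm (w - u.1) i).trans_lt (by rwa [← dist_eq_norm])
    have h2 := (Complex.re_le_norm (w i - u.1 i))
    rw [Complex.sub_re] at h2
    linarith [hθu i]
  have hre : ∀ w ∈ Metric.ball u.1 (θ / 2), ∀ y : State m n,
      ‖Complex.exp (pairing y (w, u.2))‖ ≤ Real.exp (-(θ / 2 * ∑ i, (y.1 i : ℝ))) := by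
    intro w hw y
    rw [Complex.norm_exp, Real.exp_le_exp, re_pairing, Finset.mul_sum, ← Finset.sum_neg_distrib]
    simp only [hu.2, mul_zero, Finset.sum_const_zero, add_zero]
    refine Finset.sum_le_sum fun i _ => ?_
    have := mul_le_mul_of_nonneg_left (hball w hw i) (y.1 i).coe_nonneg
    linarith
  simp_rw [X.charFun_eq]
  let L : State m n → ((Fin m → ℂ) →L[ℂ] ℂ) := fun y =>
    ∑ i, ((y.1 i : ℝ) : ℂ) • ContinuousLinearMap.proj (R := ℂ) (φ := fun _ : Fin m => ℂ) i
  have hLc : Continuous L := by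
    refine continuous_finsetSum _ fun i _ => ?_
    have : Continuous fun y : State m n => ((y.1 i : ℝ) : ℂ) := by fun_prop
    exact this.smul continuous_const
  have hL : ∀ y, ‖L y‖ ≤ ∑ i, (y.1 i : ℝ) := by
    intro y
    refine (norm_sum_le _ _).trans (Finset.sum_le_sum fun i _ => ?_)
    rw [norm_smul, Complex.norm_real, Real.norm_of_nonneg (y.1 i).coe_nonneg]
    refine mul_le_of_le_one_right (y.1 i).2 ?_
    refine ContinuousLinearMap.opNorm_le_bound _ zero_le_one fun w => ?_
    rw [one_mul]
    exact norm_le_pi_norm w i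
  have hcont : ∀ w : Fin m → ℂ, Continuous fun y : State m n => Complex.exp (pairing y (w, u.2)) :=
    fun w => by fun_prop
  refine (hasFDerivAt_integral_of_dominated_of_fderiv_le (𝕜 := ℂ)
    (F' := fun w y => Complex.exp (pairing y (w, u.2)) • L y)
    (bound := fun _ => (θ / 2)⁻¹) (Metric.ball_mem_nhds u.1 (half_pos hθ))
    (Eventually.of_forall fun w => (hcont w).aestronglyMeasurable)
    (X.integrable_exp_pairing x t (interiorU_subset hu))
    (((hcont u.1).smul hLc).aestronglyMeasurable) (Eventually.of_forall fun y w hw => ?_)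
    (integrable_const _) (Eventually.of_forall fun y w hw => ?_)).differentiableAt
  · rw [norm_smul]
    set S := ∑ i, (y.1 i : ℝ) with hS
    have hS0 : 0 ≤ S := Finset.sum_nonneg fun i _ => (y.1 i).2
    calc _ ≤ Real.exp (-(θ / 2 * S)) * S :=
          mul_le_mul (hre w hw y) (hL y) (norm_nonneg _) (Real.exp_pos _).le
      _ ≤ (θ / 2)⁻¹ := by
          rw [Real.exp_neg, inv_mul_le_iff₀ (Real.exp_pos _), ← div_eq_mul_inv,
            le_div_iff₀ (half_pos hθ)]
          linarith [Real.add_one_le_exp (θ / 2 * S)]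
  · refine HasFDerivAt.cexp ?_
    have h1 : HasFDerivAt (fun w => L y w) (L y) w := (L y).hasFDerivAt
    have h2 := h1.add_const (∑ j, (y.2 j : ℂ) * u.2 j)
    have h3 : (fun w => L y w + ∑ j, (y.2 j : ℂ) * u.2 j) = fun w => pairing y (w, u.2) := by
      funext w
      simp [L, pairing]
    rwa [h3] at h2

theorem tendsto_slice {t : ℝ≥0} {u : CVec m n} (hu : u ∈ interiorU m n) :
    Tendsto (fun w : Fin m → ℂ => (t, (w, u.2))) (𝓝 u.1)
      (𝓝[{q : ℝ≥0 × CVec m n | q.2 ∈ cU m n}] (t, u)) := by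
  refine tendsto_nhdsWithin_iff.2 ⟨(by fun_prop : Continuous fun w : Fin m → ℂ =>
    (t, (w, u.2))).tendsto u.1, ?_⟩
  have h : ∀ i, ∀ᶠ w : Fin m → ℂ in 𝓝 u.1, (w i).re < 0 := fun i =>
    ((by fun_prop : Continuous fun w : Fin m → ℂ => (w i).re).tendsto u.1).eventually
      (gt_mem_nhds (hu.1 i))
  filter_upwards [eventually_all.2 h] with w hw
  exact ⟨fun i => (hw i).le, hu.2⟩

/-- The exponential of ψ_i is the ratio of the expectations started at e_i and at 0, both
holomorphic. -/
theorem differentiableAt_psi (hA : X.IsAffine) (hS : X.IsStochContinuous)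
    (hH : X.IsSemiHomogeneous) {t : ℝ≥0} {u : CVec m n} (hu : u ∈ interiorU m n)
    (hq : (t, u) ∈ X.domQ) :
    DifferentiableAt ℂ (fun w : Fin m → ℂ => (X.psi (t, (w, u.2))).1) u.1 := by
  have hsl := tendsto_slice (t := t) hu
  have hQ : ∀ᶠ w in 𝓝 u.1, (t, (w, u.2)) ∈ X.domQ := hsl.eventually (domQ_mem_nhdsWithin hS hq)
  have hψ : ContinuousAt (fun w : Fin m → ℂ => X.psi (t, (w, u.2))) u.1 :=
    (continuousOn_psi hA hS hH _ hq).tendsto.comp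
      (tendsto_nhdsWithin_iff.2 ⟨hsl.mono_right nhdsWithin_le_nhds, hQ⟩)
  refine differentiableAt_pi.2 fun i => differentiableAt_of_differentiableAt_exp ?_ ?_
  · exact (by fun_prop : Continuous fun v : CVec m n => v.1 i).continuousAt.comp hψ
  · have hinv : DifferentiableAt ℂ (fun w : Fin m → ℂ => (X.charFun 0 t (w, u.2))⁻¹) u.1 :=
      (differentiableAt_charFun (X := X) 0 t hu).fun_inv hq.2
    refine ((differentiableAt_charFun (X := X) (single i 1) t hu).fun_mul
      hinv).congr_of_eventuallyEq ?_
    filter_upwards [hQ] with w hw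
    have h := charFun_eq_mul_exp hA hH hw (single i 1)
    simp only at h
    rw [h, ← div_eq_mul_inv, mul_div_cancel_left₀ _ hw.2, pairing_single]
    simp

end MarkovProcess

/-! ### Differentiability at time 0 of holomorphic semiflows -/

section Semiflow

variable {E P : Type*} [NormedAddCommGroup E] [NormedSpace ℂ E] [TopologicalSpace P]

/-- A holomorphic map close to the identity differs from it by a map with small Lipschitz
constant. -/
theorem norm_sub_sub_le_of_close_to_id {f : E → E} {e₀ e v : E} {ρ η : ℝ} (hρ : 0 < ρ)
    (hd : DifferentiableOn ℂ f (Metric.ball e₀ ρ))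
    (hη : ∀ e ∈ Metric.ball e₀ ρ, ‖f e - e‖ ≤ η) (he : e ∈ Metric.ball e₀ (ρ / 4))
    (hv : ‖v - e‖ < ρ / 2) : ‖(f v - v) - (f e - e)‖ ≤ 4 * η / ρ * ‖v - e‖ := by
  have hsub : Metric.ball e (ρ / 2) ⊆ Metric.ball e₀ ρ := by
    refine Metric.ball_subset_ball' ?_
    rw [Metric.mem_ball] at he
    linarith
  have hmaps : MapsTo (fun x => f x - x) (Metric.ball e (ρ / 2))
      (Metric.closedBall (f e - e) (2 * η)) := by
    intro x hx
    rw [mem_closedBall_iff_norm]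
    refine (norm_sub_le _ _).trans ?_
    linarith [hη x (hsub hx), hη e (hsub (Metric.mem_ball_self (by linarith)))]
  -- Schwarz lemma for f - id, from radius ρ/2 to radius 2η, whence the constant 4η/ρ.
  have h := Complex.dist_le_div_mul_dist_of_mapsTo_ball (E := E) (F := E)
    ((hd.mono hsub).sub differentiableOn_id) hmaps (z := v) (by rwa [mem_ball_iff_norm])
  simp only [Pi.sub_apply, id, dist_eq_norm] at h
  refine h.trans (le_of_eq ?_)
  field_simp
  ring

/-- The difference quotients at time `0` of a holomorphic local semiflow converge. -/
theorem exists_tendsto_semiflow_slope [CompleteSpace E] {Ψ : ℝ → P → E → E} {p₀ : P} {e₀ : E}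
    {ρ δ : ℝ} (hρ : 0 < ρ) (hδ : 0 < δ)
    (hdiff : ∀ᶠ z : ℝ × P in 𝓝 (0, p₀), DifferentiableOn ℂ (Ψ z.1 z.2) (Metric.ball e₀ ρ))
    (hunif : ∀ η > 0, ∀ᶠ z : ℝ × P in 𝓝 (0, p₀), ∀ e ∈ Metric.ball e₀ ρ, ‖Ψ z.1 z.2 e - e‖ ≤ η)
    (hcont : ∀ᶠ s in 𝓝[>] (0 : ℝ),
      ContinuousAt (fun z : ℝ × P × E => Ψ z.1 z.2.1 z.2.2) (s, p₀, e₀))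
    (hzero : ∀ᶠ p in 𝓝 p₀, ∀ e ∈ Metric.ball e₀ ρ, Ψ 0 p e = e)
    (hflow : ∀ᶠ p in 𝓝 p₀, ∀ e ∈ Metric.ball e₀ ρ, ∀ s t : ℝ, 0 ≤ s → 0 ≤ t → t + s ≤ δ →
      Ψ (t + s) p e = Ψ s p (Ψ t p e)) :
    ∃ c, Tendsto (fun z : ℝ × P × E => ((z.1⁻¹ : ℝ) : ℂ) • (Ψ z.1 z.2.1 z.2.2 - z.2.2))
      (𝓝[>] 0 ×ˢ 𝓝 (p₀, e₀)) (𝓝 c) := by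
  set D : ℝ × P × E → E := fun z => ((z.1⁻¹ : ℝ) : ℂ) • (Ψ z.1 z.2.1 z.2.2 - z.2.2) with hD
  set l : Filter (ℝ × P × E) := 𝓝[>] (0 : ℝ) ×ˢ 𝓝 (p₀, e₀) with hl
  have hl1 : Tendsto (fun z : ℝ × P × E => z.1) l (𝓝[>] 0) := tendsto_fst
  have hl2 : Tendsto (fun z : ℝ × P × E => z.2) l (𝓝 (p₀, e₀)) := tendsto_snd
  have hlp : Tendsto (fun z : ℝ × P × E => z.2.1) l (𝓝 p₀) :=
    (continuous_fst.tendsto (p₀, e₀)).comp hl2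
  have hle : Tendsto (fun z : ℝ × P × E => z.2.2) l (𝓝 e₀) :=
    (continuous_snd.tendsto (p₀, e₀)).comp hl2
  -- A difference quotient at one fixed small time s serves as the approximate limit a, up to an
  -- error relative to D itself.
  have key : ∀ ε > 0, ∃ a, ∀ᶠ z in l, ‖D z - a‖ ≤ ε * ‖D z‖ + ε := by
    intro ε hε
    -- The first bound makes the Lipschitz constant 4η/ρ at most ε; the second keeps Ψ_t e within
    -- ρ/2 of e, where the Schwarz estimate applies.
    set η := min (ε * ρ / 4) (ρ / 4) with hηdef
    have hη : 0 < η := by positivity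
    have hboth := (hdiff.and (hunif η hη))
    rw [nhds_prod_eq, eventually_prod_iff] at hboth
    obtain ⟨pa, hpa, pb, hpb, hab⟩ := hboth
    obtain ⟨δ', hδ', hball⟩ := Metric.eventually_nhds_iff.1 hpa
    have hs : ∀ᶠ s in 𝓝[>] (0 : ℝ), s ≤ δ ∧ s < δ' ∧ 0 < s := by
      filter_upwards [Ioc_mem_nhdsGT hδ, Ioo_mem_nhdsGT hδ'] with s h1 h2
      exact ⟨h1.2, h2.2, h1.1⟩
    obtain ⟨s, hsc, hsδ, hsδ', hs0⟩ := (hcont.and hs).exists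
    have hgood : ∀ t, 0 ≤ t → t ≤ s → pa t := fun t ht hts => hball (by
      rw [Real.dist_eq, sub_zero, abs_of_nonneg ht]; linarith)
    -- The largest multiple of t not exceeding s; it tends to s as t → 0.
    set K : ℝ × P × E → ℝ := fun z => (⌊s / z.1⌋₊ : ℝ) * z.1 with hK
    have hKs : ∀ z : ℝ × P × E, 0 < z.1 → K z ≤ s ∧ s - z.1 ≤ K z := by
      intro z hz
      have h1 := Nat.floor_le (div_nonneg hs0.le hz.le)
      have h2 := Nat.lt_floor_add_one (s / z.1)
      rw [le_div_iff₀ hz] at h1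
      rw [div_lt_iff₀ hz] at h2
      exact ⟨h1, by simp only [hK]; linarith⟩
    have hpos : ∀ᶠ z in l, 0 < z.1 := hl1.eventually self_mem_nhdsWithin
    have hlt : ∀ᶠ z in l, z.1 < s :=
      (hl1.mono_right nhdsWithin_le_nhds).eventually (gt_mem_nhds hs0)
    have hKlim : Tendsto K l (𝓝 s) := by
      have h1 : Tendsto (fun z : ℝ × P × E => s - z.1) l (𝓝 s) := by
        simpa using (hl1.mono_right nhdsWithin_le_nhds).const_sub s
      refine tendsto_of_tendsto_of_tendsto_of_le_of_le' h1 tendsto_const_nhds ?_ ?_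
      · filter_upwards [hpos] with z hz using (hKs z hz).2
      · filter_upwards [hpos] with z hz using (hKs z hz).1
    have hDK : Tendsto (fun z : ℝ × P × E => D (K z, z.2)) l (𝓝 (D (s, p₀, e₀))) := by
      have h1 : Tendsto (fun z : ℝ × P × E => (K z, z.2)) l (𝓝 (s, p₀, e₀)) :=
        hKlim.prodMk_nhds hl2
      have h2 : ContinuousAt D (s, p₀, e₀) := by
        refine ContinuousAt.smul ?_ (hsc.sub (by fun_prop))
        exact Complex.continuous_ofReal.continuousAt.comp
          (ContinuousAt.inv₀ continuousAt_fst hs0.ne')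
      exact h2.tendsto.comp h1
    refine ⟨D (s, p₀, e₀), ?_⟩
    filter_upwards [hpos, hlt, (Metric.tendsto_nhds.1 hDK) ε hε, hlp.eventually hpb,
      hlp.eventually hzero, hlp.eventually hflow,
      hle.eventually (Metric.ball_mem_nhds e₀ (by positivity : 0 < ρ / 4))]
      with z hz hzs hdist hzb hz0 hzf hze
    obtain ⟨t, p, e⟩ := z
    simp only at hz hzs hzb hz0 hzf hze
    have hze' : e ∈ Metric.ball e₀ ρ := Metric.ball_subset_ball (by linarith) hze
    set x := Ψ t p e - e with hx
    have hxη : ‖x‖ ≤ η := (hab (hgood t hz.le hzs.le) hzb).2 e hze'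
    have hη1 : 4 * η / ρ ≤ ε := by
      rw [div_le_iff₀ hρ]
      linarith [min_le_left (ε * ρ / 4) (ρ / 4)]
    -- The displacement over kt telescopes into increments Ψ_{jt}(Ψ_t e) - Ψ_{jt}(e), each within
    -- ε‖x‖ of x because Ψ_{jt} - id has Lipschitz constant at most ε.
    have hstep : ∀ k : ℕ, k * t ≤ s → ‖Ψ (k * t) p e - e - (k : ℂ) • x‖ ≤ k * (ε * ‖x‖) := by
      intro k
      induction k with
      | zero => intro _; simp [hz0 e hze']
      | succ k ih =>
        intro hk
        push_cast at hk ⊢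
        have hk0 : 0 ≤ (k : ℝ) * t := by positivity
        have hk' : (k : ℝ) * t ≤ s := by linarith
        have hf := hzf e hze' (k * t) t hk0 hz.le (by linarith)
        have hg := hab (hgood _ hk0 hk') hzb
        have hlip := norm_sub_sub_le_of_close_to_id hρ hg.1 hg.2 hze (v := Ψ t p e)
          (hxη.trans_lt (by linarith [min_le_right (ε * ρ / 4) (ρ / 4)]))
        have e1 : Ψ ((k + 1) * t) p e - e - ((k : ℂ) + 1) • x =
            ((Ψ (k * t) p (Ψ t p e) - Ψ t p e) - (Ψ (k * t) p e - e)) +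
              (Ψ (k * t) p e - e - (k : ℂ) • x) := by
          rw [show ((k : ℝ) + 1) * t = t + k * t by ring, hf, hx]
          module
        rw [e1]
        refine (norm_add_le _ _).trans ?_
        have := mul_le_mul_of_nonneg_right hη1 (norm_nonneg x)
        linarith [ih hk']
    have hk := hstep ⌊s / t⌋₊ (hKs (t, p, e) hz).1
    have hkpos : 0 < K (t, p, e) := lt_of_lt_of_le (by simpa using hzs) (hKs (t, p, e) hz).2
    set k := ⌊s / t⌋₊ with hkdef
    have hDD : D (K (t, p, e), p, e) - D (t, p, e) =
        (((K (t, p, e))⁻¹ : ℝ) : ℂ) • (Ψ (k * t) p e - e - (k : ℂ) • x) := by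
      have hKe : K (t, p, e) = k * t := rfl
      have hkne : (k : ℂ) ≠ 0 := by
        intro h0
        rw [hKe] at hkpos
        have : (k : ℝ) = 0 := by exact_mod_cast h0
        rw [this, zero_mul] at hkpos
        exact lt_irrefl _ hkpos
      have htne : (t : ℂ) ≠ 0 := by exact_mod_cast hz.ne'
      simp only [hD, ← hx]
      rw [hKe, smul_sub _ _ ((k : ℂ) • x), smul_smul]
      congr 2
      push_cast
      field_simp
    have hDnorm : ‖D (K (t, p, e), p, e) - D (t, p, e)‖ ≤ ε * ‖D (t, p, e)‖ := by
      rw [hDD, norm_smul, Complex.norm_real, norm_inv, Real.norm_of_nonneg hkpos.le,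
        inv_mul_le_iff₀ hkpos]
      refine hk.trans (le_of_eq ?_)
      simp only [hD, ← hx, norm_smul, Complex.norm_real, norm_inv, Real.norm_of_nonneg hz.le, hK,
        ← hkdef]
      field_simp
    rw [dist_eq_norm] at hdist
    have e2 : D (t, p, e) - D (s, p₀, e₀) = (D (K (t, p, e), p, e) - D (s, p₀, e₀)) -
        (D (K (t, p, e), p, e) - D (t, p, e)) := by abel
    rw [e2]
    refine (norm_sub_le _ _).trans ?_
    linarith
  obtain ⟨C, hC, hCb⟩ : ∃ C : ℝ, 0 ≤ C ∧ ∀ᶠ z in l, ‖D z‖ ≤ C := by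
    -- With ε = 1/2 the term ε‖D‖ can be absorbed, which bounds D; boundedness then turns the
    -- relative error into an absolute one.
    obtain ⟨a, ha⟩ := key (1 / 2) (by norm_num)
    refine ⟨2 * ‖a‖ + 1, by positivity, ?_⟩
    filter_upwards [ha] with z hz
    have := norm_sub_norm_le (D z) a
    linarith
  have hCauchy : Cauchy (map D l) := by
    rw [Metric.cauchy_iff]
    refine ⟨inferInstance, fun ε hε => ?_⟩
    obtain ⟨a, ha⟩ := key (ε / 4 / (C + 1)) (by positivity)
    refine ⟨Metric.closedBall a (ε / 4), ?_, fun x hx y hy => ?_⟩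
    · change ∀ᶠ z in l, D z ∈ Metric.closedBall a (ε / 4)
      filter_upwards [ha, hCb] with z hz hzC
      rw [mem_closedBall_iff_norm]
      refine hz.trans ?_
      have h1 : ε / 4 / (C + 1) * ‖D z‖ ≤ ε / 4 / (C + 1) * C :=
        mul_le_mul_of_nonneg_left hzC (by positivity)
      have h2 : ε / 4 / (C + 1) * (C + 1) = ε / 4 := div_mul_cancel₀ _ (by positivity)
      linarith
    · rw [Metric.mem_closedBall] at hx hy
      have := dist_triangle_right x y a
      linarith
  exact cauchy_iff_exists_le_nhds.1 hCauchy

end Semiflow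

/-! ### Boundary limits of normalized increments -/

section Extension

variable {m n : ℕ}

/-- The function `y ↦ e^{⟨y - x, u⟩}`. -/
def relExp (x y : State m n) (u : CVec m n) : ℂ := Complex.exp (pairing y u - pairing x u)

/-- The normalized increment `c (∫ e^{⟨y - x, u⟩} μ(dy) - 1)`. -/
def relSlope (c : ℝ) (μ : Measure (State m n)) (x : State m n) (u : CVec m n) : ℂ :=
  c * (∫ y, relExp x y u ∂μ - 1)

theorem relExp_add (x y : State m n) (u v : CVec m n) :
    relExp x y (u + v) = relExp x y u * relExp x y v := by
  rw [relExp, relExp, relExp, ← Complex.exp_add, pairing_add_right, pairing_add_right]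
  congr 1
  ring

theorem relExp_zero (x y : State m n) : relExp x y 0 = 1 := by
  simp [relExp, pairing]

theorem pairing_star (x : State m n) (u : CVec m n) :
    pairing x (star u) = (starRingEnd ℂ) (pairing x u) := by
  simp [pairing]

theorem relExp_star (x y : State m n) (u : CVec m n) :
    relExp x y (star u) = (starRingEnd ℂ) (relExp x y u) := by
  rw [relExp, relExp, pairing_star, pairing_star, ← Complex.exp_conj, map_sub]

theorem norm_relExp_le (x y : State m n) {u : CVec m n} (hu : u ∈ cU m n) :
    ‖relExp x y u‖ ≤ Real.exp (-(pairing x u).re) := by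
  rw [relExp, Complex.norm_exp, Complex.sub_re]
  exact Real.exp_le_exp.2 (by linarith [re_pairing_nonpos y hu])

theorem continuous_relExp (x : State m n) (u : CVec m n) : Continuous fun y => relExp x y u := by
  unfold relExp
  fun_prop

theorem integrable_relExp {μ : Measure (State m n)} [IsFiniteMeasure μ] (x : State m n)
    {u : CVec m n} (hu : u ∈ cU m n) : Integrable (fun y => relExp x y u) μ :=
  Integrable.of_bound (C := Real.exp (-(pairing x u).re))
    (continuous_relExp x u).aestronglyMeasurable
    (Eventually.of_forall fun y => norm_relExp_le x y hu)

theorem star_mem_cU {u : CVec m n} (hu : u ∈ cU m n) : star u ∈ cU m n :=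
  ⟨fun i => by simpa using hu.1 i, fun j => by simpa using hu.2 j⟩

theorem zero_mem_cU : (0 : CVec m n) ∈ cU m n := ⟨fun i => by simp, fun j => by simp⟩

theorem add_mem_cU {u v : CVec m n} (hu : u ∈ cU m n) (hv : v ∈ cU m n) : u + v ∈ cU m n :=
  ⟨fun i => by simpa using add_nonpos (hu.1 i) (hv.1 i), fun j => by simp [hu.2 j, hv.2 j]⟩

/-- Expansion of the square, since `relExp` turns sums into products and `star` into conjugation. -/
theorem norm_relExp_sub_sq (x y : State m n) (u v : CVec m n) :
    ‖relExp x y u - relExp x y v‖ ^ 2 = (relExp x y (u + star u)).re -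
      2 * (relExp x y (u + star v)).re + (relExp x y (v + star v)).re := by
  simp only [relExp_add, relExp_star]
  rw [← Complex.normSq_eq_norm_sq, Complex.normSq_sub, Complex.mul_conj, Complex.mul_conj,
    Complex.ofReal_re, Complex.ofReal_re]
  ring

theorem integrable_norm_relExp_sub_sq {μ : Measure (State m n)} [IsFiniteMeasure μ]
    (x : State m n) {u v : CVec m n} (hu : u ∈ cU m n) (hv : v ∈ cU m n) :
    Integrable (fun y => ‖relExp x y u - relExp x y v‖ ^ 2) μ := by
  simp_rw [norm_relExp_sub_sq]
  exact ((integrable_relExp x (add_mem_cU hu (star_mem_cU hu))).re.sub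
    ((integrable_relExp x (add_mem_cU hu (star_mem_cU hv))).re.const_mul 2)).add
    (integrable_relExp x (add_mem_cU hv (star_mem_cU hv))).re

theorem re_relSlope (c : ℝ) (μ : Measure (State m n)) [IsFiniteMeasure μ] (x : State m n)
    {u : CVec m n} (hu : u ∈ cU m n) :
    (relSlope c μ x u).re = c * (∫ y, (relExp x y u).re ∂μ - 1) := by
  rw [relSlope, Complex.re_ofReal_mul, Complex.sub_re, Complex.one_re]
  have : ∫ y, (relExp x y u).re ∂μ = (∫ y, relExp x y u ∂μ).re :=
    integral_re (𝕜 := ℂ) (integrable_relExp x hu)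
  rw [this]

/-- The coefficients 1, -2, 1 sum to 0, so the constants -1 in the slopes cancel. -/
theorem mul_integral_norm_relExp_sub_sq (c : ℝ) (μ : Measure (State m n)) [IsFiniteMeasure μ]
    (x : State m n) {u v : CVec m n} (hu : u ∈ cU m n) (hv : v ∈ cU m n) :
    c * ∫ y, ‖relExp x y u - relExp x y v‖ ^ 2 ∂μ = (relSlope c μ x (u + star u)).re -
      2 * (relSlope c μ x (u + star v)).re + (relSlope c μ x (v + star v)).re := by
  have h1 := add_mem_cU hu (star_mem_cU hu)
  have h2 := add_mem_cU hu (star_mem_cU hv)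
  have h3 := add_mem_cU hv (star_mem_cU hv)
  have i1 : Integrable (fun y => (relExp x y (u + star u)).re) μ := (integrable_relExp x h1).re
  have i2 : Integrable (fun y => (relExp x y (u + star v)).re) μ := (integrable_relExp x h2).re
  have i3 : Integrable (fun y => (relExp x y (v + star v)).re) μ := (integrable_relExp x h3).re
  rw [re_relSlope c μ x h1, re_relSlope c μ x h2, re_relSlope c μ x h3]
  simp_rw [norm_relExp_sub_sq]
  have i12 : Integrable (fun y => (relExp x y (u + star u)).re -
    2 * (relExp x y (u + star v)).re) μ := i1.sub (i2.const_mul 2)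
  rw [integral_add i12 i3, integral_sub i1 (i2.const_mul 2), integral_const_mul]
  ring

theorem negOnes_add (a b : ℝ) : (negOnes a + negOnes b : CVec m n) = negOnes (a + b) := by
  refine Prod.ext (funext fun i => ?_) (funext fun j => ?_)
  · simp [negOnes, add_comm]
  · simp [negOnes]

theorem star_negOnes (a : ℝ) : star (negOnes a : CVec m n) = negOnes a := by
  refine Prod.ext (funext fun i => ?_) (funext fun j => ?_)
  · simp [negOnes]
  · simp [negOnes]

theorem continuous_negOnes : Continuous fun θ : ℝ => (negOnes θ : CVec m n) := by
  unfold negOnes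
  fun_prop

theorem negOnes_zero : (negOnes 0 : CVec m n) = 0 := by
  refine Prod.ext (funext fun i => ?_) (funext fun j => ?_)
  · simp [negOnes]
  · simp [negOnes]

theorem re_relExp_negOnes (x y : State m n) (θ : ℝ) :
    (relExp x y (negOnes θ)).re =
      Real.exp (θ * ((∑ i, (x.1 i : ℝ)) - ∑ i, (y.1 i : ℝ))) := by
  have : pairing y (negOnes θ) - pairing x (negOnes θ) =
      ((θ * ((∑ i, (x.1 i : ℝ)) - ∑ i, (y.1 i : ℝ)) : ℝ) : ℂ) := by
    simp only [pairing, negOnes, Pi.zero_apply, mul_zero, Finset.sum_const_zero, add_zero]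
    push_cast
    simp only [mul_sub, Finset.mul_sum, ← Finset.sum_sub_distrib]
    exact Finset.sum_congr rfl fun i _ => by ring
  rw [relExp, this, Complex.exp_ofReal_re]

theorem re_relSlope_negOnes_convex {c : ℝ} (hc : 0 ≤ c) (μ : Measure (State m n))
    [IsFiniteMeasure μ] (x : State m n) :
    ConvexOn ℝ (Ici 0) fun θ => (relSlope c μ x (negOnes θ)).re := by
  refine ⟨convex_Ici 0, fun θ hθ θ' hθ' a b ha hb hab => ?_⟩
  have hm : 0 ≤ a * θ + b * θ' :=
    add_nonneg (mul_nonneg ha hθ) (mul_nonneg hb hθ')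
  have hint : ∀ {θ : ℝ}, 0 ≤ θ → Integrable (fun y => (relExp x y (negOnes θ)).re) μ :=
    fun h => (integrable_relExp x (negOnes_mem_cU h)).re
  simp only [smul_eq_mul]
  rw [re_relSlope c μ x (negOnes_mem_cU hm), re_relSlope c μ x (negOnes_mem_cU hθ),
    re_relSlope c μ x (negOnes_mem_cU hθ')]
  have h1 : ∫ y, (relExp x y (negOnes (a * θ + b * θ'))).re ∂μ ≤
      a * ∫ y, (relExp x y (negOnes θ)).re ∂μ + b * ∫ y, (relExp x y (negOnes θ')).re ∂μ := by
    rw [← integral_const_mul, ← integral_const_mul,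
      ← integral_add ((hint hθ).const_mul a) ((hint hθ').const_mul b)]
    refine integral_mono (hint hm) (((hint hθ).const_mul a).add ((hint hθ').const_mul b))
      fun y => ?_
    simp only [re_relExp_negOnes]
    rw [add_mul, mul_assoc, mul_assoc]
    exact convexOn_exp.2 (mem_univ _) (mem_univ _) ha hb hab
  have h2 := mul_le_mul_of_nonneg_left h1 hc
  have h3 : c = a * c + b * c := by rw [← add_mul, hab, one_mul]
  linarith

/-- The slope at 0 measures the loss of mass by killing. It has a sign, even though its limit is not
known to exist. -/
theorem re_relSlope_zero_nonpos {c : ℝ} (hc : 0 ≤ c) {μ : Measure (State m n)}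
    (hμ : μ univ ≤ 1) (x : State m n) : (relSlope c μ x 0).re ≤ 0 := by
  have hm : μ.real univ ≤ 1 := ENNReal.toReal_le_of_le_ofReal zero_le_one (by simpa using hμ)
  simp only [relSlope, relExp_zero, integral_const, Complex.re_ofReal_mul]
  simp only [Complex.real_smul, mul_one, Complex.sub_re, Complex.ofReal_re, Complex.one_re]
  exact mul_nonpos_of_nonneg_of_nonpos hc (by linarith)

/-- A convex function on `(0, ∞)` which is bounded above near `0` has a limit at `0`. -/
theorem exists_tendsto_of_convexOn {g : ℝ → ℝ} (hg : ConvexOn ℝ (Ioi 0) g)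
    (hb : ∀ θ ∈ Ioo (0 : ℝ) 1, g θ ≤ θ * g 1) : ∃ L, Tendsto g (𝓝[>] 0) (𝓝 L) := by
  set s : ℝ → ℝ := fun θ => (g θ - g 1) / (θ - 1) with hs
  -- Secant slopes through 1 are monotone, and the hypothesis g θ ≤ θ g 1 says exactly that they are
  -- bounded below by g 1.
  have hmono : MonotoneOn s (Ioo 0 1) := fun a ha b hb hab =>
    hg.secant_mono (mem_Ioi.2 one_pos) ha.1 hb.1 ha.2.ne hb.2.ne hab
  have hbdd : BddBelow (s '' Ioo 0 1) := by
    refine ⟨g 1, ?_⟩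
    rintro _ ⟨θ, hθ, rfl⟩
    have h1 : 0 < 1 - θ := by linarith [hθ.2]
    have : s θ = (g 1 - g θ) / (1 - θ) := by
      simp only [hs]
      rw [← neg_sub (g 1), ← neg_sub (1 : ℝ) θ, neg_div_neg_eq]
    rw [this, le_div_iff₀ h1]
    linarith [hb θ hθ]
  have h1 := hmono.tendsto_nhdsWithin_Ioo_right (nonempty_Ioo.2 one_pos) hbdd
  have hid : Tendsto (fun θ : ℝ => θ - 1) (𝓝[>] 0) (𝓝 (0 - 1)) :=
    (tendsto_id.sub_const 1).mono_left nhdsWithin_le_nhds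
  have h2 := (h1.mul hid).const_add (g 1)
  refine ⟨_, h2.congr' ?_⟩
  filter_upwards [Ioo_mem_nhdsGT (zero_lt_one' ℝ)] with θ hθ
  have : θ - 1 ≠ 0 := by linarith [hθ.2]
  simp only [hs]
  field_simp
  ring

variable {T : Type*} {l : Filter T} {c : T → ℝ} {μ : T → Measure (State m n)}
  [∀ t, IsFiniteMeasure (μ t)] {x : State m n} {G : CVec m n → ℂ}

/-- Convexity in θ survives the limit, and the nonpositive value at θ = 0 gives the chord bound θ
g(1) needed near 0. -/
theorem exists_tendsto_re_negOnes [l.NeBot] (hc : ∀ᶠ t in l, 0 ≤ c t) (hμ : ∀ t, μ t univ ≤ 1)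
    (hG : ∀ u ∈ interiorU m n, Tendsto (fun t => relSlope (c t) (μ t) x u) l (𝓝 (G u))) :
    ∃ L, Tendsto (fun θ => (G (negOnes θ)).re) (𝓝[>] 0) (𝓝 L) := by
  have hlim : ∀ θ : ℝ, 0 < θ → Tendsto (fun t => (relSlope (c t) (μ t) x (negOnes θ)).re) l
      (𝓝 (G (negOnes θ)).re) := fun θ hθ =>
    (Complex.continuous_re.tendsto _).comp (hG _ (negOnes_mem_interiorU hθ))
  refine exists_tendsto_of_convexOn ⟨convex_Ioi 0, fun θ hθ θ' hθ' a b ha hb hab => ?_⟩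
    fun θ hθ => ?_
  · have hpos : a • θ + b • θ' ∈ Ioi (0 : ℝ) := convex_Ioi 0 hθ hθ' ha hb hab
    refine le_of_tendsto_of_tendsto (hlim _ hpos)
      (((hlim θ hθ).const_smul a).add ((hlim θ' hθ').const_smul b)) ?_
    filter_upwards [hc] with t ht
    exact (re_relSlope_negOnes_convex ht (μ t) x).2 (mem_Ici.2 (le_of_lt hθ))
      (mem_Ici.2 (le_of_lt hθ')) ha hb hab
  · refine le_of_tendsto_of_tendsto (hlim _ hθ.1) ((hlim 1 one_pos).const_mul θ) ?_
    filter_upwards [hc] with t ht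
    have hcv := (re_relSlope_negOnes_convex ht (μ t) x).2
    have h1 := hcv (mem_Ici.2 le_rfl) (mem_Ici.2 zero_le_one)
      (show 0 ≤ 1 - θ by linarith [hθ.2]) hθ.1.le (by ring)
    simp only [smul_eq_mul, mul_zero, mul_one, zero_add, negOnes_zero] at h1
    have h2 := mul_nonneg (by linarith [hθ.2] : 0 ≤ 1 - θ)
      (neg_nonneg.2 (re_relSlope_zero_nonpos ht (hμ t) x))
    linarith

theorem tendsto_mul_integral_norm_relExp_sub_sq
    (hG : ∀ u ∈ interiorU m n, Tendsto (fun t => relSlope (c t) (μ t) x u) l (𝓝 (G u)))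
    {u v : CVec m n} (hu : u ∈ interiorU m n) (hv : v ∈ interiorU m n) :
    Tendsto (fun t => c t * ∫ y, ‖relExp x y u - relExp x y v‖ ^ 2 ∂μ t) l
      (𝓝 ((G (u + star u)).re - 2 * (G (u + star v)).re + (G (v + star v)).re)) := by
  have hre : ∀ w ∈ interiorU m n, Tendsto (fun t => (relSlope (c t) (μ t) x w).re) l
      (𝓝 (G w).re) := fun w hw => (Complex.continuous_re.tendsto _).comp (hG w hw)
  have hmem : ∀ {a b : CVec m n}, a ∈ interiorU m n → b ∈ interiorU m n →
      a + star b ∈ interiorU m n := fun ha hb => by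
    rw [add_comm]; exact add_mem_interiorU (star_mem_cU (interiorU_subset hb)) ha
  refine (((hre _ (hmem hu hu)).sub ((hre _ (hmem hu hv)).const_mul 2)).add
    (hre _ (hmem hv hv))).congr fun t => ?_
  rw [mul_integral_norm_relExp_sub_sq _ _ _ (interiorU_subset hu) (interiorU_subset hv)]

/-- The square expansion with v = 0. As 0 need not be an interior point, its slope is discarded by
sign rather than evaluated in the limit; the 1 is slack. -/
theorem eventually_mul_integral_norm_relExp_sub_one_sq_le (hc : ∀ᶠ t in l, 0 ≤ c t)
    (hμ : ∀ t, μ t univ ≤ 1)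
    (hG : ∀ u ∈ interiorU m n, Tendsto (fun t => relSlope (c t) (μ t) x u) l (𝓝 (G u)))
    {u : CVec m n} (hu : u ∈ interiorU m n) :
    ∀ᶠ t in l, c t * ∫ y, ‖relExp x y u - 1‖ ^ 2 ∂μ t ≤
      (G (u + star u)).re - 2 * (G u).re + 1 := by
  have hre : ∀ w ∈ interiorU m n, Tendsto (fun t => (relSlope (c t) (μ t) x w).re) l
      (𝓝 (G w).re) := fun w hw => (Complex.continuous_re.tendsto _).comp (hG w hw)
  have huu : u + star u ∈ interiorU m n := by
    rw [add_comm]; exact add_mem_interiorU (star_mem_cU (interiorU_subset hu)) hu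
  have h := (hre _ huu).sub ((hre u hu).const_mul 2)
  filter_upwards [hc, h.eventually (gt_mem_nhds (lt_add_one _))] with t ht h1
  have h2 := mul_integral_norm_relExp_sub_sq (c t) (μ t) x (interiorU_subset hu) zero_mem_cU
  simp only [relExp_zero, star_zero, add_zero] at h2
  rw [h2]
  linarith [re_relSlope_zero_nonpos ht (hμ t) x]

/-- The constant must not degenerate as a approaches the boundary. Hence a is compared with a + w
for the fixed interior vector w, and a + w stays near an interior point where G is continuous. -/
theorem exists_bound_mul_integral_norm_relExp_sub_one_sq (hc : ∀ᶠ t in l, 0 ≤ c t)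
    (hμ : ∀ t, μ t univ ≤ 1)
    (hG : ∀ u ∈ interiorU m n, Tendsto (fun t => relSlope (c t) (μ t) x u) l (𝓝 (G u)))
    (hGc : ContinuousOn G (interiorU m n)) {u₀ : CVec m n} (hu₀ : u₀ ∈ cU m n) :
    ∃ C : ℝ, ∀ᶠ a in 𝓝[interiorU m n] u₀, ∀ᶠ t in l,
      c t * ∫ y, ‖relExp x y a - 1‖ ^ 2 ∂μ t ≤ C := by
  set w : CVec m n := negOnes 1 with hw
  have hwU : w ∈ interiorU m n := negOnes_mem_interiorU one_pos
  have hshift : Tendsto (fun a => a + w) (𝓝[interiorU m n] u₀) (𝓝[interiorU m n] (u₀ + w)) :=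
    tendsto_nhdsWithin_iff.2 ⟨((by fun_prop : Continuous fun a : CVec m n => a + w).tendsto
      u₀).mono_left nhdsWithin_le_nhds, by
        filter_upwards [self_mem_nhdsWithin] with a ha
        exact add_mem_interiorU (interiorU_subset ha) hwU⟩
  have hmem : ∀ {b : CVec m n}, b ∈ interiorU m n → b + star b ∈ interiorU m n := fun hb => by
    rw [add_comm]; exact add_mem_interiorU (star_mem_cU (interiorU_subset hb)) hb
  have hw0 := add_mem_interiorU hu₀ hwU
  have hshift2 : Tendsto (fun b : CVec m n => b + star b) (𝓝[interiorU m n] (u₀ + w))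
      (𝓝[interiorU m n] ((u₀ + w) + star (u₀ + w))) :=
    tendsto_nhdsWithin_iff.2 ⟨((by fun_prop : Continuous fun b : CVec m n => b + star b).tendsto
      _).mono_left nhdsWithin_le_nhds, by
        filter_upwards [self_mem_nhdsWithin] with b hb using hmem hb⟩
  have hH : Tendsto (fun a => (G ((a + w) + star (a + w))).re - 2 * (G (a + w)).re + 1)
      (𝓝[interiorU m n] u₀)
      (𝓝 ((G ((u₀ + w) + star (u₀ + w))).re - 2 * (G (u₀ + w)).re + 1)) := by
    have h1 := (hGc _ (hmem hw0)).tendsto.comp (hshift2.comp hshift)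
    have h2 := (hGc _ hw0).tendsto.comp hshift
    exact ((((Complex.continuous_re.tendsto _).comp h1).sub
      (((Complex.continuous_re.tendsto _).comp h2).const_mul 2)).add_const 1)
  have hE : Tendsto (fun a : CVec m n => Real.exp (-(pairing x a).re)) (𝓝[interiorU m n] u₀)
      (𝓝 (Real.exp (-(pairing x u₀).re))) :=
    (((Real.continuous_exp.comp (Complex.continuous_re.comp
      (by fun_prop : Continuous fun a : CVec m n => pairing x a)).neg)).tendsto u₀).mono_left
      nhdsWithin_le_nhds
  set A := (G (w + star w)).re - 2 * (G w).re + 1 with hA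
  set B := (G ((u₀ + w) + star (u₀ + w))).re - 2 * (G (u₀ + w)).re + 1 with hB
  set K := Real.exp (-(pairing x u₀).re) + 1 with hK
  refine ⟨2 * (K ^ 2 * A) + 2 * (B + 1), ?_⟩
  filter_upwards [self_mem_nhdsWithin, hH.eventually (gt_mem_nhds (lt_add_one _)),
    hE.eventually (gt_mem_nhds (lt_add_one _))] with a ha hHa hEa
  have haw := add_mem_interiorU (interiorU_subset ha) hwU
  filter_upwards [hc, eventually_mul_integral_norm_relExp_sub_one_sq_le hc hμ hG hwU,
    eventually_mul_integral_norm_relExp_sub_one_sq_le hc hμ hG haw] with t ht h1 h2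
  have hi : ∀ {b : CVec m n}, b ∈ cU m n → Integrable (fun y => ‖relExp x y b - 1‖ ^ 2) (μ t) := by
    intro b hb
    have := integrable_norm_relExp_sub_sq (μ := μ t) x hb zero_mem_cU
    simpa only [relExp_zero] using this
  have hpt : ∀ y, ‖relExp x y a - 1‖ ^ 2 ≤
      2 * K ^ 2 * ‖relExp x y w - 1‖ ^ 2 + 2 * ‖relExp x y (a + w) - 1‖ ^ 2 := by
    intro y
    have e : relExp x y a - 1 =
        -(relExp x y a * (relExp x y w - 1)) + (relExp x y (a + w) - 1) := by
      rw [relExp_add]; ring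
    have hb : ‖relExp x y a - 1‖ ≤ K * ‖relExp x y w - 1‖ + ‖relExp x y (a + w) - 1‖ := by
      rw [e]
      refine (norm_add_le _ _).trans (add_le_add ?_ le_rfl)
      rw [norm_neg, norm_mul]
      exact mul_le_mul_of_nonneg_right
        ((norm_relExp_le x y (interiorU_subset ha)).trans hEa.le) (norm_nonneg _)
    have h3 := pow_le_pow_left₀ (norm_nonneg _) hb 2
    refine h3.trans ?_
    linarith [sq_nonneg (K * ‖relExp x y w - 1‖ - ‖relExp x y (a + w) - 1‖)]
  have hI := integral_mono (hi (interiorU_subset ha))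
    (((hi (interiorU_subset hwU)).const_mul (2 * K ^ 2)).add
      ((hi (interiorU_subset haw)).const_mul 2)) hpt
  simp only [Pi.add_apply] at hI
  rw [integral_add ((hi (interiorU_subset hwU)).const_mul (2 * K ^ 2))
    ((hi (interiorU_subset haw)).const_mul 2), integral_const_mul, integral_const_mul] at hI
  have h4 := mul_le_mul_of_nonneg_left hI ht
  have h5 := mul_le_mul_of_nonneg_left h1 (by positivity : 0 ≤ 2 * K ^ 2)
  linarith

/-- The second difference is the limit of c ∫ (e^a - e^{a'})(e^{-δ} - e^{-(δ+ε)}) dμ, in the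
notation of `relExp`. Young's inequality with weight `lam` splits it into two L² quantities. -/
theorem norm_second_difference_le [l.NeBot]
    (hc : ∀ᶠ t in l, 0 ≤ c t)
    (hG : ∀ u ∈ interiorU m n, Tendsto (fun t => relSlope (c t) (μ t) x u) l (𝓝 (G u)))
    {a a' : CVec m n} (ha : a ∈ interiorU m n) (ha' : a' ∈ interiorU m n) {C lam δ ε : ℝ}
    (hlam : 0 < lam) (hδ : 0 < δ) (hε : 0 < ε)
    (hC : ∀ᶠ t in l, c t * ∫ y, ‖relExp x y a - 1‖ ^ 2 ∂μ t ≤ C)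
    (hC' : ∀ᶠ t in l, c t * ∫ y, ‖relExp x y a' - 1‖ ^ 2 ∂μ t ≤ C) :
    ‖(G (a + negOnes δ) - G (a' + negOnes δ)) -
        (G (a + negOnes (δ + ε)) - G (a' + negOnes (δ + ε)))‖ ≤
      lam * ((G (negOnes (δ + δ))).re - 2 * (G (negOnes (δ + (δ + ε)))).re +
        (G (negOnes ((δ + ε) + (δ + ε)))).re) + 4 * C / lam := by
  have hs : (negOnes δ : CVec m n) ∈ interiorU m n := negOnes_mem_interiorU hδ
  have hr : (negOnes (δ + ε) : CVec m n) ∈ interiorU m n := negOnes_mem_interiorU (by linarith)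
  have m1 := add_mem_interiorU (interiorU_subset ha) hs
  have m2 := add_mem_interiorU (interiorU_subset ha') hs
  have m3 := add_mem_interiorU (interiorU_subset ha) hr
  have m4 := add_mem_interiorU (interiorU_subset ha') hr
  have hlim := (((hG _ m1).sub (hG _ m2)).sub ((hG _ m3).sub (hG _ m4))).norm
  have hA := tendsto_mul_integral_norm_relExp_sub_sq hG hs hr
  simp only [star_negOnes, negOnes_add] at hA
  refine le_of_tendsto_of_tendsto hlim ((hA.const_mul lam).add_const (4 * C / lam)) ?_
  filter_upwards [hc, hC, hC'] with t ht h1 h2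
  have hi : ∀ {b : CVec m n}, b ∈ cU m n → Integrable (fun y => ‖relExp x y b - 1‖ ^ 2) (μ t) := by
    intro b hb
    have := integrable_norm_relExp_sub_sq (μ := μ t) x hb zero_mem_cU
    simpa only [relExp_zero] using this
  have hie : ∀ {b : CVec m n}, b ∈ interiorU m n → Integrable (fun y => relExp x y b) (μ t) :=
    fun hb => integrable_relExp x (interiorU_subset hb)
  have e : (relSlope (c t) (μ t) x (a + negOnes δ) - relSlope (c t) (μ t) x (a' + negOnes δ)) -
      (relSlope (c t) (μ t) x (a + negOnes (δ + ε)) -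
        relSlope (c t) (μ t) x (a' + negOnes (δ + ε))) =
      c t * ∫ y, (relExp x y a - relExp x y a') *
        (relExp x y (negOnes δ) - relExp x y (negOnes (δ + ε))) ∂μ t := by
    have : ∀ y, (relExp x y a - relExp x y a') *
        (relExp x y (negOnes δ) - relExp x y (negOnes (δ + ε))) =
        (relExp x y (a + negOnes δ) - relExp x y (a' + negOnes δ)) -
        (relExp x y (a + negOnes (δ + ε)) - relExp x y (a' + negOnes (δ + ε))) := by
      intro y
      simp only [relExp_add]
      ring
    simp_rw [this]
    have j1 : Integrable (fun y => relExp x y (a + negOnes δ) - relExp x y (a' + negOnes δ)) (μ t) :=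
      (hie m1).sub (hie m2)
    have j2 : Integrable (fun y => relExp x y (a + negOnes (δ + ε)) -
      relExp x y (a' + negOnes (δ + ε))) (μ t) := (hie m3).sub (hie m4)
    rw [integral_sub j1 j2,
      integral_sub (hie m1) (hie m2), integral_sub (hie m3) (hie m4)]
    simp only [relSlope]
    ring
  rw [e, norm_mul, Complex.norm_real, Real.norm_of_nonneg ht]
  have hiA := integrable_norm_relExp_sub_sq (μ := μ t) x (interiorU_subset hs)
    (interiorU_subset hr)
  have hpt : ∀ y, ‖(relExp x y a - relExp x y a') *
      (relExp x y (negOnes δ) - relExp x y (negOnes (δ + ε)))‖ ≤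
      lam * ‖relExp x y (negOnes δ) - relExp x y (negOnes (δ + ε))‖ ^ 2 +
        2 / lam * (‖relExp x y a - 1‖ ^ 2 + ‖relExp x y a' - 1‖ ^ 2) := by
    intro y
    rw [norm_mul]
    set p := ‖relExp x y (negOnes δ) - relExp x y (negOnes (δ + ε))‖
    set q := ‖relExp x y a - 1‖
    set q' := ‖relExp x y a' - 1‖
    have h3 : ‖relExp x y a - relExp x y a'‖ ≤ q + q' := by
      have : relExp x y a - relExp x y a' = (relExp x y a - 1) - (relExp x y a' - 1) := by ring
      rw [this]
      exact norm_sub_le _ _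
    have hp : 0 ≤ p := norm_nonneg _
    have h4 := mul_le_mul_of_nonneg_right h3 hp
    refine h4.trans ?_
    have h5 : (q + q') * p ≤ lam * p ^ 2 + 1 / lam * (q + q') ^ 2 := by
      have h6 : lam * p ^ 2 + 1 / lam * (q + q') ^ 2 - (q + q') * p =
          (1 / lam) * ((lam * p - (q + q') / 2) ^ 2 + 3 / 4 * (q + q') ^ 2) := by
        field_simp
        ring
      have h7 : 0 ≤ (1 / lam) * ((lam * p - (q + q') / 2) ^ 2 + 3 / 4 * (q + q') ^ 2) := by
        positivity
      linarith
    have h8 : 1 / lam * (q + q') ^ 2 ≤ 2 / lam * (q ^ 2 + q' ^ 2) := by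
      have h9 : 2 / lam * (q ^ 2 + q' ^ 2) - 1 / lam * (q + q') ^ 2 =
          1 / lam * (q - q') ^ 2 := by ring
      have : 0 ≤ 1 / lam * (q - q') ^ 2 := by positivity
      linarith
    linarith
  have hiB : Integrable (fun y => ‖relExp x y a - 1‖ ^ 2 + ‖relExp x y a' - 1‖ ^ 2) (μ t) :=
    (hi (interiorU_subset ha)).add (hi (interiorU_subset ha'))
  have hI := norm_integral_le_of_norm_le ((hiA.const_mul lam).add (hiB.const_mul (2 / lam)))
    (Eventually.of_forall hpt)
  refine (mul_le_mul_of_nonneg_left hI ht).trans ?_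
  simp only [Pi.add_apply]
  rw [integral_add (hiA.const_mul lam) (hiB.const_mul (2 / lam)), integral_const_mul,
    integral_const_mul, integral_add (hi (interiorU_subset ha)) (hi (interiorU_subset ha'))]
  have h10 := mul_le_mul_of_nonneg_left (add_le_add h1 h2) (by positivity : 0 ≤ 2 / lam)
  have h11 : 2 / lam * (C + C) = 4 * C / lam := by ring
  linarith

/-- A pointwise limit of normalized increments on the interior of `𝒰`, if continuous there, has
limits at all points of `𝒰`. -/
theorem exists_tendsto_boundary [l.NeBot] (hc : ∀ᶠ t in l, 0 ≤ c t) (hμ : ∀ t, μ t univ ≤ 1)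
    (hG : ∀ u ∈ interiorU m n, Tendsto (fun t => relSlope (c t) (μ t) x u) l (𝓝 (G u)))
    (hGc : ContinuousOn G (interiorU m n)) {u₀ : CVec m n} (hu₀ : u₀ ∈ cU m n)
    (hne : (𝓝[interiorU m n] u₀).NeBot) :
    ∃ z, Tendsto G (𝓝[interiorU m n] u₀) (𝓝 z) := by
  obtain ⟨C, hC⟩ := exists_bound_mul_integral_norm_relExp_sub_one_sq hc hμ hG hGc hu₀
  obtain ⟨L, hL⟩ := exists_tendsto_re_negOnes hc hμ hG
  suffices Cauchy (map G (𝓝[interiorU m n] u₀)) from cauchy_iff_exists_le_nhds.1 this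
  rw [Metric.cauchy_iff]
  refine ⟨inferInstance, fun η hη => ?_⟩
  -- Chosen so that 4C/lam ≤ η/4, whatever the sign of C.
  set lam := 16 * (|C| + 1) / η with hlamdef
  have hlam : 0 < lam := by positivity
  have hClam : 4 * C / lam ≤ η / 4 := by
    rw [div_le_iff₀ hlam, hlamdef]
    have : η / 4 * (16 * (|C| + 1) / η) = 4 * (|C| + 1) := by field_simp; ring
    rw [this]
    linarith [le_abs_self C]
  have hLη := (Metric.tendsto_nhds.1 hL) (η / (16 * lam)) (by positivity)
  obtain ⟨τ, hτ, hτL⟩ := (mem_nhdsGT_iff_exists_Ioo_subset' (zero_lt_one' ℝ)).1 hLη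
  have hτ' : (0 : ℝ) < τ := hτ
  -- For δ < ε the arguments 2δ, 2δ + ε and 2δ + 2ε are all below τ/2, where the real part is within
  -- η/(16 lam) of L.
  set ε := τ / 8 with hεdef
  have hε : 0 < ε := by positivity
  have hwU : (negOnes ε : CVec m n) ∈ interiorU m n := negOnes_mem_interiorU hε
  have hshift : Tendsto (fun a => a + negOnes ε) (𝓝[interiorU m n] u₀)
      (𝓝[interiorU m n] (u₀ + negOnes ε)) :=
    tendsto_nhdsWithin_iff.2 ⟨((by fun_prop : Continuous fun a : CVec m n =>
      a + negOnes ε).tendsto u₀).mono_left nhdsWithin_le_nhds, by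
        filter_upwards [self_mem_nhdsWithin] with a ha
        exact add_mem_interiorU (interiorU_subset ha) hwU⟩
  have hGε := (hGc _ (add_mem_interiorU hu₀ hwU)).tendsto.comp hshift
  have hGε' := (Metric.tendsto_nhds.1 hGε) (η / 16) (by positivity)
  obtain ⟨r, hr, hrC⟩ := Metric.mem_nhdsWithin_iff.1 hC
  have hev : ∀ᶠ u in 𝓝[interiorU m n] u₀, u ∈ Metric.ball u₀ (r / 2) ∧ u ∈ interiorU m n ∧
      dist (G (u + negOnes ε)) (G (u₀ + negOnes ε)) < η / 16 := by
    filter_upwards [mem_nhdsWithin_of_mem_nhds (Metric.ball_mem_nhds u₀ (half_pos hr)),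
      self_mem_nhdsWithin, hGε'] with u h1 h2 h3 using ⟨h1, h2, h3⟩
  refine ⟨G '' {u | u ∈ Metric.ball u₀ (r / 2) ∧ u ∈ interiorU m n ∧
      dist (G (u + negOnes ε)) (G (u₀ + negOnes ε)) < η / 16}, image_mem_map hev, ?_⟩
  rintro _ ⟨u, ⟨hur, hu, hud⟩, rfl⟩ _ ⟨u', ⟨hur', hu', hud'⟩, rfl⟩
  -- Each interior point is written as v = a + `negOnes δ` with a still interior and near u₀. The
  -- shift δ depends on u and u', but the final estimate does not.
  have hδex : ∀ᶠ δ in 𝓝[>] (0 : ℝ), (δ < ε ∧ 0 < δ) ∧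
      (∀ v ∈ ({u, u'} : Set (CVec m n)), v + negOnes (-δ) ∈ interiorU m n ∧
        v + negOnes (-δ) ∈ Metric.ball u₀ r) := by
    have h1 : ∀ v ∈ ({u, u'} : Set (CVec m n)), ∀ᶠ δ in 𝓝[>] (0 : ℝ),
        v + negOnes (-δ) ∈ interiorU m n ∧ v + negOnes (-δ) ∈ Metric.ball u₀ r := by
      intro v hv
      have hvU : v ∈ interiorU m n ∧ v ∈ Metric.ball u₀ (r / 2) := by
        rcases hv with rfl | rfl
        exacts [⟨hu, hur⟩, ⟨hu', hur'⟩]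
      obtain ⟨θ, hθ, -, hθv⟩ := exists_le_neg hvU.1
      have hcont : Tendsto (fun δ : ℝ => v + negOnes (-δ)) (𝓝[>] 0) (𝓝 v) := by
        have : Tendsto (fun δ : ℝ => v + negOnes (-δ)) (𝓝 0) (𝓝 (v + negOnes (-0))) :=
          (continuous_const.add (continuous_negOnes.comp continuous_neg)).tendsto 0
        rw [neg_zero, negOnes_zero, add_zero] at this
        exact this.mono_left nhdsWithin_le_nhds
      filter_upwards [hcont.eventually (Metric.isOpen_ball.mem_nhds
        (Metric.ball_subset_ball (half_le_self hr.le) hvU.2)), Ioo_mem_nhdsGT hθ] with δ h2 h3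
      refine ⟨⟨fun i => ?_, fun j => ?_⟩, h2⟩
      · simp only [negOnes, Prod.fst_add, Pi.add_apply, Complex.add_re, Complex.ofReal_re]
        linarith [hθv i, h3.2]
      · simp [negOnes, hvU.1.2 j]
    have h2 := (h1 u (by simp)).and (h1 u' (by simp))
    filter_upwards [Ioo_mem_nhdsGT hε, h2] with δ h3 h4
    refine ⟨⟨h3.2, h3.1⟩, ?_⟩
    rintro v (rfl | rfl)
    exacts [h4.1, h4.2]
  obtain ⟨δ, ⟨hδε, hδ⟩, hδv⟩ := hδex.exists
  have hcancel : ∀ (v : CVec m n) (κ : ℝ), v + negOnes (-δ) + negOnes (δ + κ) = v + negOnes κ := by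
    intro v κ
    rw [add_assoc, negOnes_add]
    congr 2
    ring
  have hcancel0 : ∀ v : CVec m n, v + negOnes (-δ) + negOnes δ = v := by
    intro v
    have := hcancel v 0
    rwa [add_zero, negOnes_zero, add_zero] at this
  have ha := hδv u (by simp)
  have ha' := hδv u' (by simp)
  have hmain := norm_second_difference_le hc hG ha.1 ha'.1 hlam hδ hε
    (hrC ⟨ha.2, ha.1⟩) (hrC ⟨ha'.2, ha'.1⟩)
  rw [hcancel, hcancel, hcancel0, hcancel0] at hmain
  have hgL : ∀ θ, 0 < θ → θ < τ → |(G (negOnes θ)).re - L| < η / (16 * lam) := fun θ h1 h2 => by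
    have := hτL ⟨h1, h2⟩
    rwa [mem_ofPred_eq, Real.dist_eq] at this
  have g1 := abs_lt.1 (hgL (δ + δ) (by linarith) (by linarith))
  have g2 := abs_lt.1 (hgL (δ + (δ + ε)) (by linarith) (by linarith))
  have g3 := abs_lt.1 (hgL ((δ + ε) + (δ + ε)) (by linarith) (by linarith))
  have hA : lam * ((G (negOnes (δ + δ))).re - 2 * (G (negOnes (δ + (δ + ε)))).re +
        (G (negOnes ((δ + ε) + (δ + ε)))).re) ≤ η / 4 := by
    have : η / 4 = lam * (4 * (η / (16 * lam))) := by field_simp; ring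
    rw [this]
    exact mul_le_mul_of_nonneg_left (by linarith) hlam.le
  have hfin : dist (G (u + negOnes ε)) (G (u' + negOnes ε)) < η / 8 := by
    have := dist_triangle_right (G (u + negOnes ε)) (G (u' + negOnes ε)) (G (u₀ + negOnes ε))
    linarith
  rw [dist_eq_norm] at hfin ⊢
  have := norm_sub_norm_le (G u - G u') (G (u + negOnes ε) - G (u' + negOnes ε))
  linarith

end Extension

/-! ### Derivatives at time 0 in the interior -/

namespace MarkovProcess

variable {m n : ℕ} {Ω : Type*} [MeasurableSpace Ω] {X : MarkovProcess m n Ω}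

/-- The vector `(a, i p)`. -/
def _root_.AffineProc.sliceVec {m n : ℕ} (a : Fin m → ℂ) (p : Fin n → ℝ) : CVec m n :=
  (a, fun j => p j * Complex.I)

variable (X) in
/-- The semiflow `(w, u_I) ↦ (w Φ(t, u), ψ_I(t, u))` with parameter `p = Im u_J`. -/
def flow (t : ℝ) (p : Fin n → ℝ) (e : ℂ × (Fin m → ℂ)) : ℂ × (Fin m → ℂ) :=
  (e.1 * X.charFun 0 t.toNNReal (sliceVec e.2 p), (X.psi (t.toNNReal, sliceVec e.2 p)).1)

theorem sliceVec_im {u : CVec m n} (hu : u ∈ cU m n) :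
    sliceVec u.1 (fun j => (u.2 j).im) = u := by
  refine Prod.ext rfl (funext fun j => ?_)
  simp [sliceVec, Complex.ext_iff, hu.2 j]

theorem sliceVec_mem_interiorU {a : Fin m → ℂ} (ha : ∀ i, (a i).re < 0) (p : Fin n → ℝ) :
    sliceVec a p ∈ interiorU m n :=
  ⟨ha, fun j => by simp [sliceVec]⟩

theorem tendsto_sliceVec (hS : X.IsStochContinuous) {t : ℝ} {p : Fin n → ℝ}
    {e : ℂ × (Fin m → ℂ)} (he : ∀ i, (e.2 i).re < 0)
    (hq : (t.toNNReal, sliceVec e.2 p) ∈ X.domQ) :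
    Tendsto (fun z : ℝ × (Fin n → ℝ) × ℂ × (Fin m → ℂ) => (z.1.toNNReal, sliceVec z.2.2.2 z.2.1))
      (𝓝 (t, p, e)) (𝓝[X.domQ] (t.toNNReal, sliceVec e.2 p)) := by
  have hc : Continuous fun z : ℝ × (Fin n → ℝ) × ℂ × (Fin m → ℂ) =>
      (z.1.toNNReal, (sliceVec z.2.2.2 z.2.1 : CVec m n)) := by
    unfold sliceVec
    fun_prop
  have h1 : Tendsto (fun z : ℝ × (Fin n → ℝ) × ℂ × (Fin m → ℂ) =>
      (z.1.toNNReal, sliceVec z.2.2.2 z.2.1)) (𝓝 (t, p, e))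
      (𝓝[{q | q.2 ∈ cU m n}] (t.toNNReal, sliceVec e.2 p)) := by
    refine tendsto_nhdsWithin_iff.2 ⟨hc.tendsto (t, p, e), ?_⟩
    have h : ∀ i, ∀ᶠ z : ℝ × (Fin n → ℝ) × ℂ × (Fin m → ℂ) in 𝓝 (t, p, e),
        (z.2.2.2 i).re < 0 := fun i =>
      ((by fun_prop : Continuous fun z : ℝ × (Fin n → ℝ) × ℂ × (Fin m → ℂ) =>
        (z.2.2.2 i).re).tendsto (t, p, e)).eventually (gt_mem_nhds (he i))
    filter_upwards [eventually_all.2 h] with z hz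
    exact interiorU_subset (sliceVec_mem_interiorU hz _)
  exact tendsto_nhdsWithin_iff.2 ⟨h1.mono_right nhdsWithin_le_nhds,
    h1.eventually (domQ_mem_nhdsWithin hS hq)⟩

theorem continuousAt_flow (hA : X.IsAffine) (hS : X.IsStochContinuous) (hH : X.IsSemiHomogeneous)
    {t : ℝ} {p : Fin n → ℝ} {e : ℂ × (Fin m → ℂ)} (he : ∀ i, (e.2 i).re < 0)
    (hq : (t.toNNReal, sliceVec e.2 p) ∈ X.domQ) :
    ContinuousAt (fun z : ℝ × (Fin n → ℝ) × ℂ × (Fin m → ℂ) => X.flow z.1 z.2.1 z.2.2)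
      (t, p, e) := by
  have h := tendsto_sliceVec hS he hq
  have hΦ := ((isAffineExtension_psi hA hS hH).continuousOn_Φ _ hq).tendsto.comp h
  have hψ := (continuousOn_psi hA hS hH _ hq).tendsto.comp h
  have hψ1 := (continuous_fst.tendsto _).comp hψ
  have hw : Tendsto (fun z : ℝ × (Fin n → ℝ) × ℂ × (Fin m → ℂ) => z.2.2.1) (𝓝 (t, p, e))
      (𝓝 e.1) := (by fun_prop : Continuous fun z : ℝ × (Fin n → ℝ) × ℂ × (Fin m → ℂ) =>
        z.2.2.1).tendsto (t, p, e)
  exact (hw.mul hΦ).prodMk_nhds hψ1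

theorem flow_zero (hA : X.IsAffine) (hH : X.IsSemiHomogeneous) (p : Fin n → ℝ)
    {e : ℂ × (Fin m → ℂ)} (he : ∀ i, (e.2 i).re < 0) : X.flow 0 p e = e := by
  have hU := interiorU_subset (sliceVec_mem_interiorU he p)
  simp only [flow, Real.toNNReal_zero, psi_zero hA hH hU, X.charFun_zero, pairing_zero_left,
    Complex.exp_zero, mul_one]
  rfl

/-- The extra factor w absorbs the cocycle Φ, so that (Φ, ψ_I) becomes one semiflow; the parameter p
persists because ψ_J = u_J. -/
theorem flow_add (hA : X.IsAffine) (hH : X.IsSemiHomogeneous) {s t : ℝ} (hs : 0 ≤ s) (ht : 0 ≤ t)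
    {p : Fin n → ℝ} {e : ℂ × (Fin m → ℂ)}
    (hq : (t.toNNReal, sliceVec e.2 p) ∈ X.domQ)
    (hq' : ((t + s).toNNReal, sliceVec e.2 p) ∈ X.domQ) :
    X.flow (t + s) p e = X.flow s p (X.flow t p e) := by
  rw [Real.toNNReal_add ht hs] at hq'
  have hv : sliceVec (X.psi (t.toNNReal, sliceVec e.2 p)).1 p =
      X.psi (t.toNNReal, sliceVec e.2 p) :=
    Prod.ext rfl (psi_snd hA hH hq).symm
  simp only [flow, hv, Real.toNNReal_add ht hs, charFun_zero_add hA hH hq, psi_add hA hH hq hq',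
    mul_assoc]

theorem differentiableAt_flow (hA : X.IsAffine) (hS : X.IsStochContinuous)
    (hH : X.IsSemiHomogeneous) {t : ℝ} {p : Fin n → ℝ} {e : ℂ × (Fin m → ℂ)}
    (he : ∀ i, (e.2 i).re < 0) (hq : (t.toNNReal, sliceVec e.2 p) ∈ X.domQ) :
    DifferentiableAt ℂ (X.flow t p) e := by
  have hU := sliceVec_mem_interiorU he p
  have h1 := (differentiableAt_charFun (X := X) 0 t.toNNReal hU)
  have h2 := differentiableAt_psi hA hS hH hU hq
  have h1' : DifferentiableAt ℂ (fun e : ℂ × (Fin m → ℂ) =>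
      X.charFun 0 t.toNNReal (sliceVec e.2 p)) e :=
    DifferentiableAt.comp (g := fun w : Fin m → ℂ => X.charFun 0 t.toNNReal (sliceVec w p)) e h1
      differentiableAt_snd
  have h2' : DifferentiableAt ℂ (fun e : ℂ × (Fin m → ℂ) =>
      (X.psi (t.toNNReal, sliceVec e.2 p)).1) e :=
    DifferentiableAt.comp (g := fun w : Fin m → ℂ => (X.psi (t.toNNReal, sliceVec w p)).1) e h2
      differentiableAt_snd
  exact (differentiableAt_fst.fun_mul h1').prodMk h2'

variable (X) in
/-- The difference quotient of `(Φ, ψ_I)` at time `0`. -/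
def quotient (z : ℝ × CVec m n) : ℂ × (Fin m → ℂ) :=
  ((z.1⁻¹ : ℝ) : ℂ) • (X.charFun 0 z.1.toNNReal z.2 - 1, (X.psi (z.1.toNNReal, z.2)).1 - z.2.1)

theorem exists_tendsto_quotient (hA : X.IsAffine) (hS : X.IsStochContinuous)
    (hH : X.IsSemiHomogeneous) {u₀ : CVec m n} (hu₀ : u₀ ∈ interiorU m n) :
    ∃ c, Tendsto X.quotient (𝓝[>] 0 ×ˢ 𝓝[interiorU m n] u₀) (𝓝 c) := by
  set p₀ : Fin n → ℝ := fun j => (u₀.2 j).im with hp₀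
  -- At w = 1 the first component of the displacement is Φ - 1.
  set e₀ : ℂ × (Fin m → ℂ) := (1, u₀.1) with he₀
  obtain ⟨θ, hθ, -, hθu⟩ := exists_le_neg hu₀
  set ρ := θ / 2 with hρdef
  have hρ : 0 < ρ := half_pos hθ
  have hre : ∀ e ∈ Metric.closedBall e₀ ρ, ∀ i, (e.2 i).re < 0 := by
    intro e he i
    rw [mem_closedBall_iff_norm] at he
    have h1 : ‖e.2 i - u₀.1 i‖ ≤ ρ :=
      (norm_le_pi_norm (e.2 - u₀.1) i).trans ((norm_snd_le (e - e₀)).trans he)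
    have h2 := Complex.re_le_norm (e.2 i - u₀.1 i)
    rw [Complex.sub_re] at h2
    linarith [hθu i]
  have hK : IsCompact (Metric.closedBall e₀ ρ) := isCompact_closedBall e₀ ρ
  have hQ0 : ∀ e ∈ Metric.closedBall e₀ ρ, ((0 : ℝ).toNNReal, sliceVec e.2 p₀) ∈ X.domQ := by
    intro e he
    rw [Real.toNNReal_zero]
    exact zero_mem_domQ (interiorU_subset (sliceVec_mem_interiorU (hre e he) p₀))
  have hassoc : ∀ e : ℂ × (Fin m → ℂ), Tendsto
      (fun z : (ℝ × (Fin n → ℝ)) × ℂ × (Fin m → ℂ) => (z.1.1, z.1.2, z.2)) (𝓝 ((0, p₀), e))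
      (𝓝 (0, p₀, e)) := fun e =>
    (by fun_prop : Continuous fun z : (ℝ × (Fin n → ℝ)) × ℂ × (Fin m → ℂ) =>
      (z.1.1, z.1.2, z.2)).tendsto ((0, p₀), e)
  have hQ : ∀ᶠ z : ℝ × (Fin n → ℝ) in 𝓝 (0, p₀), ∀ e ∈ Metric.closedBall e₀ ρ,
      (z.1.toNNReal, sliceVec e.2 z.2) ∈ X.domQ := by
    -- Compactness of the closed ball makes the time and parameter neighbourhood uniform in e.
    refine hK.eventually_forall_of_forall_eventually fun e he => ?_
    exact (hassoc e).eventually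
      ((tendsto_sliceVec hS (hre e he) (hQ0 e he)).eventually self_mem_nhdsWithin)
  have hunif : ∀ η > 0, ∀ᶠ z : ℝ × (Fin n → ℝ) in 𝓝 (0, p₀), ∀ e ∈ Metric.ball e₀ ρ,
      ‖X.flow z.1 z.2 e - e‖ ≤ η := by
    intro η hη
    have : ∀ᶠ z : ℝ × (Fin n → ℝ) in 𝓝 (0, p₀), ∀ e ∈ Metric.closedBall e₀ ρ,
        ‖X.flow z.1 z.2 e - e‖ ≤ η := by
      refine hK.eventually_forall_of_forall_eventually fun e he => ?_
      have h1 := (continuousAt_flow hA hS hH (hre e he) (hQ0 e he)).tendsto.comp (hassoc e)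
      have h2 := (h1.sub (continuous_snd.tendsto ((0, p₀), e))).norm
      simp only [flow_zero hA hH p₀ (hre e he), sub_self, norm_zero] at h2
      filter_upwards [h2.eventually (gt_mem_nhds hη)] with z hz using hz.le
    filter_upwards [this] with z hz e he using hz e (Metric.ball_subset_closedBall he)
  have hdiff : ∀ᶠ z : ℝ × (Fin n → ℝ) in 𝓝 (0, p₀),
      DifferentiableOn ℂ (X.flow z.1 z.2) (Metric.ball e₀ ρ) := by
    filter_upwards [hQ] with z hz e he
    have he' := Metric.ball_subset_closedBall he
    exact (differentiableAt_flow hA hS hH (hre e he') (hz e he')).differentiableWithinAt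
  have hQ' := hQ
  rw [nhds_prod_eq, eventually_prod_iff] at hQ'
  obtain ⟨pa, hpa, pb, hpb, hab⟩ := hQ'
  obtain ⟨δ, hδ, hball⟩ := Metric.eventually_nhds_iff.1 hpa
  have hgood : ∀ t, 0 ≤ t → t ≤ δ / 2 → pa t := fun t h0 h1 => hball (by
    rw [Real.dist_eq, sub_zero, abs_of_nonneg h0]; linarith)
  have hcont : ∀ᶠ s in 𝓝[>] (0 : ℝ), ContinuousAt
      (fun z : ℝ × (Fin n → ℝ) × ℂ × (Fin m → ℂ) => X.flow z.1 z.2.1 z.2.2) (s, p₀, e₀) := by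
    filter_upwards [Ioc_mem_nhdsGT (half_pos hδ)] with s hs
    have he := Metric.mem_closedBall_self (x := e₀) hρ.le
    exact continuousAt_flow hA hS hH (hre e₀ he)
      (hab (hgood s hs.1.le hs.2) hpb.self_of_nhds e₀ he)
  obtain ⟨c, hc⟩ := exists_tendsto_semiflow_slope hρ (half_pos hδ) hdiff hunif hcont
    (Eventually.of_forall fun p e he =>
      flow_zero hA hH p (hre e (Metric.ball_subset_closedBall he)))
    (by
      filter_upwards [hpb] with p hp e he s t hs ht hst
      have he' := Metric.ball_subset_closedBall he
      exact flow_add hA hH hs ht (hab (hgood t ht (by linarith)) hp e he')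
        (hab (hgood _ (by linarith) hst) hp e he'))
  refine ⟨c, ?_⟩
  have hmap : Tendsto (fun z : ℝ × CVec m n =>
      (z.1, (fun j => (z.2.2 j).im), ((1 : ℂ), z.2.1))) (𝓝[>] 0 ×ˢ 𝓝[interiorU m n] u₀)
      (𝓝[>] 0 ×ˢ 𝓝 (p₀, e₀)) := by
    refine tendsto_fst.prodMk ?_
    exact ((by fun_prop : Continuous fun u : CVec m n =>
      ((fun j => (u.2 j).im), ((1 : ℂ), u.1))).tendsto u₀).comp
      (tendsto_snd.mono_right nhdsWithin_le_nhds)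
  refine (hc.comp hmap).congr' ?_
  have hmem : ∀ᶠ z : ℝ × CVec m n in 𝓝[>] 0 ×ˢ 𝓝[interiorU m n] u₀, z.2 ∈ interiorU m n :=
    tendsto_snd.eventually self_mem_nhdsWithin
  filter_upwards [hmem] with z hz
  have hs := sliceVec_im (interiorU_subset hz)
  simp only [Function.comp_apply, flow, quotient, hs, one_mul]
  rfl

/-- Convergence along the product filter is locally uniform in z in the needed sense: freezing z and
letting the other variable run places c z close to c z₀. -/
theorem _root_.AffineProc.continuousOn_of_tendsto_prod {S Z E : Type*} [TopologicalSpace Z]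
    [PseudoMetricSpace E] {f : S × Z → E} {l : Filter S} [l.NeBot] {s : Set Z} {c : Z → E}
    (h : ∀ z ∈ s, Tendsto f (l ×ˢ 𝓝[s] z) (𝓝 (c z))) : ContinuousOn c s := by
  intro z₀ hz₀
  refine Metric.tendsto_nhds.2 fun ε hε => ?_
  have h1 := (Metric.tendsto_nhds.1 (h z₀ hz₀)) (ε / 2) (half_pos hε)
  rw [eventually_prod_iff] at h1
  obtain ⟨pa, hpa, pb, hpb, hab⟩ := h1
  filter_upwards [hpb, self_mem_nhdsWithin] with z hz hzs
  have h2 : Tendsto (fun t => f (t, z)) l (𝓝 (c z)) :=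
    (h z hzs).comp (tendsto_id.prodMk (tendsto_const_pure.mono_right
      (pure_le_nhdsWithin hzs)))
  have h3 : dist (c z) (c z₀) ≤ ε / 2 :=
    le_of_tendsto (h2.dist tendsto_const_nhds) (by
      filter_upwards [hpa] with t ht using (hab ht hz).le)
  linarith

end MarkovProcess

/-! ### Derivatives at the boundary and regularity -/

section

variable {m n : ℕ}

theorem nhdsWithin_interiorU_neBot {u₀ : CVec m n} (hu₀ : u₀ ∈ cU m n) :
    (𝓝[interiorU m n] u₀).NeBot := by
  rw [← mem_closure_iff_nhdsWithin_neBot]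
  have h : Tendsto (fun θ : ℝ => u₀ + negOnes θ) (𝓝[>] 0) (𝓝 u₀) := by
    have : Tendsto (fun θ : ℝ => u₀ + negOnes θ) (𝓝 0) (𝓝 (u₀ + negOnes 0)) :=
      (continuous_const.add continuous_negOnes).tendsto 0
    rw [negOnes_zero, add_zero] at this
    exact this.mono_left nhdsWithin_le_nhds
  refine mem_closure_of_tendsto h ?_
  filter_upwards [self_mem_nhdsWithin] with θ hθ
  exact add_mem_interiorU hu₀ (negOnes_mem_interiorU hθ)

theorem tendsto_toNNReal_zero : Tendsto Real.toNNReal (𝓝[≥] 0) (𝓝 0) := by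
  have := (continuous_real_toNNReal.tendsto 0)
  rw [Real.toNNReal_zero] at this
  exact this.mono_left nhdsWithin_le_nhds

end

namespace MarkovProcess

variable {m n : ℕ} {Ω : Type*} [MeasurableSpace Ω] {X : MarkovProcess m n Ω}

variable (X) in
/-- The pair `(Φ, ψ_I)` as a function of time. -/
def curve (u : CVec m n) (t : ℝ) : ℂ × (Fin m → ℂ) :=
  (X.charFun 0 t.toNNReal u, (X.psi (t.toNNReal, u)).1)

theorem curve_zero (hA : X.IsAffine) (hH : X.IsSemiHomogeneous) {u : CVec m n}
    (hu : u ∈ cU m n) : X.curve u 0 = (1, u.1) := by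
  simp only [curve, Real.toNNReal_zero, psi_zero hA hH hu, X.charFun_zero, pairing_zero_left,
    Complex.exp_zero]

theorem hasDerivWithinAt_curve_iff (hA : X.IsAffine) (hH : X.IsSemiHomogeneous) {u : CVec m n}
    (hu : u ∈ cU m n) {c : ℂ × (Fin m → ℂ)} :
    HasDerivWithinAt (X.curve u) c (Ici 0) 0 ↔
      Tendsto (fun t => X.quotient (t, u)) (𝓝[>] 0) (𝓝 c) := by
  rw [← hasDerivWithinAt_Ioi_iff_Ici, hasDerivWithinAt_iff_tendsto_slope' self_notMem_Ioi]
  refine tendsto_congr fun t => ?_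
  rw [slope_def_module, curve_zero hA hH hu, sub_zero]
  simp only [quotient, curve, Prod.mk_sub_mk]
  rw [← Complex.coe_smul]

variable (X) in
/-- The derivative `(F(u), R_I(u))` of `(Φ, ψ_I)` at time `0`, for `u` in the interior of `𝒰`. -/
def interiorDeriv (u : CVec m n) : ℂ × (Fin m → ℂ) :=
  Classical.epsilon fun c => Tendsto X.quotient (𝓝[>] 0 ×ˢ 𝓝[interiorU m n] u) (𝓝 c)

theorem tendsto_quotient (hA : X.IsAffine) (hS : X.IsStochContinuous) (hH : X.IsSemiHomogeneous)
    {u : CVec m n} (hu : u ∈ interiorU m n) :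
    Tendsto X.quotient (𝓝[>] 0 ×ˢ 𝓝[interiorU m n] u) (𝓝 (X.interiorDeriv u)) :=
  Classical.epsilon_spec (exists_tendsto_quotient hA hS hH hu)

theorem continuousOn_interiorDeriv (hA : X.IsAffine) (hS : X.IsStochContinuous)
    (hH : X.IsSemiHomogeneous) : ContinuousOn X.interiorDeriv (interiorU m n) :=
  continuousOn_of_tendsto_prod fun _ hu => tendsto_quotient hA hS hH hu

theorem hasDerivWithinAt_curve (hA : X.IsAffine) (hS : X.IsStochContinuous)
    (hH : X.IsSemiHomogeneous) {u : CVec m n} (hu : u ∈ interiorU m n) :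
    HasDerivWithinAt (X.curve u) (X.interiorDeriv u) (Ici 0) 0 := by
  rw [hasDerivWithinAt_curve_iff hA hH (interiorU_subset hu)]
  exact (tendsto_quotient hA hS hH hu).comp (tendsto_id.prodMk
    (tendsto_const_pure.mono_right (pure_le_nhdsWithin hu)))

theorem eventually_mem_domQ (hS : X.IsStochContinuous) {u : CVec m n} (hu : u ∈ cU m n) :
    ∀ᶠ t in 𝓝 (0 : ℝ≥0), (t, u) ∈ X.domQ := by
  have hline : Tendsto (fun t : ℝ≥0 => (t, u)) (𝓝 0) (𝓝[{q | q.2 ∈ cU m n}] (0, u)) :=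
    tendsto_nhdsWithin_iff.2 ⟨(by fun_prop : Continuous fun t : ℝ≥0 => (t, u)).tendsto 0,
      Eventually.of_forall fun _ => hu⟩
  exact hline.eventually (domQ_mem_nhdsWithin hS (zero_mem_domQ hu))

/-- The affine formula gives E^x e^{⟨X_t - x, u⟩} = Φ(t,u) e^{⟨x_I, ψ_I(t,u) - u_I⟩}, and the
product rule applies at t = 0. -/
theorem tendsto_relSlope (hA : X.IsAffine) (hS : X.IsStochContinuous) (hH : X.IsSemiHomogeneous)
    (x : State m n) {u : CVec m n} (hu : u ∈ interiorU m n) :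
    Tendsto (fun t : ℝ => relSlope t⁻¹ (X.law t.toNNReal x) x u) (𝓝[>] 0)
      (𝓝 ((X.interiorDeriv u).1 + ∑ i, ((x.1 i : ℝ) : ℂ) * (X.interiorDeriv u).2 i)) := by
  have hu' := interiorU_subset hu
  have hd := hasDerivWithinAt_curve hA hS hH hu
  have h0 := curve_zero hA hH hu'
  have hd1 : HasDerivWithinAt (fun t => (X.curve u t).1) (X.interiorDeriv u).1 (Ici 0) 0 := hd.fst
  have hd2 : ∀ i, HasDerivWithinAt (fun t => (X.curve u t).2 i) ((X.interiorDeriv u).2 i)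
      (Ici 0) 0 := fun i => hasDerivWithinAt_pi.1 hd.snd i
  have hs : HasDerivWithinAt
      (fun t => ∑ i, ((x.1 i : ℝ) : ℂ) * ((X.curve u t).2 i - u.1 i))
      (∑ i, ((x.1 i : ℝ) : ℂ) * (X.interiorDeriv u).2 i) (Ici 0) 0 :=
    HasDerivWithinAt.fun_sum fun i _ => ((hd2 i).sub_const _).const_mul _
  have hprod := hd1.mul hs.cexp
  simp only [h0, sub_self, mul_zero, Finset.sum_const_zero, Complex.exp_zero, mul_one,
    one_mul] at hprod
  have hslope := (hasDerivWithinAt_iff_tendsto_slope' self_notMem_Ioi).1 hprod.Ioi_of_Ici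
  refine hslope.congr' ?_
  have hQ : ∀ᶠ t in 𝓝[>] (0 : ℝ), (t.toNNReal, u) ∈ X.domQ :=
    (tendsto_toNNReal_zero.mono_left (nhdsWithin_mono _ Ioi_subset_Ici_self)).eventually
      (eventually_mem_domQ hS hu')
  filter_upwards [hQ] with t ht
  rw [slope_def_module, sub_zero, ← Complex.coe_smul, smul_eq_mul, relSlope]
  congr 1
  simp only [Pi.mul_apply, h0, sub_self, mul_zero, Finset.sum_const_zero, Complex.exp_zero,
    mul_one]
  congr 1
  have h1 : ∀ y, relExp x y u = Complex.exp (pairing y u) * Complex.exp (-pairing x u) := by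
    intro y
    rw [relExp, sub_eq_add_neg, Complex.exp_add]
  simp_rw [h1]
  rw [integral_mul_const, ← X.charFun_eq, charFun_eq_mul_exp hA hH ht, mul_assoc,
    ← Complex.exp_add]
  simp only [curve]
  congr 2
  have h2 : pairing x (X.psi (t.toNNReal, u)) + -pairing x u =
      pairing x (X.psi (t.toNNReal, u) - u) := by
    rw [pairing_sub_right]; ring
  rw [h2]
  simp [pairing, psi_snd hA hH ht]

/-- The boundary limit for starting point 0 isolates F; subtracting it from the one for e_i isolates
R_i. -/
theorem exists_tendsto_interiorDeriv (hA : X.IsAffine) (hS : X.IsStochContinuous)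
    (hH : X.IsSemiHomogeneous) {u₀ : CVec m n} (hu₀ : u₀ ∈ cU m n) :
    ∃ c, Tendsto X.interiorDeriv (𝓝[interiorU m n] u₀) (𝓝 c) := by
  have hpos : ∀ᶠ t : ℝ in 𝓝[>] 0, 0 ≤ t⁻¹ := by
    filter_upwards [self_mem_nhdsWithin] with t ht using inv_nonneg.2 (le_of_lt ht)
  have hc := continuousOn_interiorDeriv hA hS hH
  have hx : ∀ x : State m n, ∃ z, Tendsto (fun u => (X.interiorDeriv u).1 +
      ∑ i, ((x.1 i : ℝ) : ℂ) * (X.interiorDeriv u).2 i) (𝓝[interiorU m n] u₀) (𝓝 z) := by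
    intro x
    refine exists_tendsto_boundary (l := 𝓝[>] (0 : ℝ)) (x := x) hpos
      (fun t => X.law_univ_le_one t.toNNReal x)
      (fun u hu => tendsto_relSlope hA hS hH x hu) ?_ hu₀ (nhdsWithin_interiorU_neBot hu₀)
    exact (by fun_prop : Continuous fun c : ℂ × (Fin m → ℂ) =>
      c.1 + ∑ i, ((x.1 i : ℝ) : ℂ) * c.2 i).comp_continuousOn hc
  obtain ⟨z, hz⟩ := hx 0
  have hz' : Tendsto (fun u => (X.interiorDeriv u).1) (𝓝[interiorU m n] u₀) (𝓝 z) := by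
    simpa using hz
  have hi : ∀ i, ∃ w, Tendsto (fun u => (X.interiorDeriv u).2 i) (𝓝[interiorU m n] u₀) (𝓝 w) := by
    intro i
    obtain ⟨w, hw⟩ := hx (single i 1)
    refine ⟨w - z, (hw.sub hz').congr fun u => ?_⟩
    simp [single, Pi.single_apply, apply_ite]
  choose w hw using hi
  exact ⟨(z, w), hz'.prodMk_nhds (tendsto_pi_nhds.2 hw)⟩

variable (X) in
/-- The pair `(F, R_I)` on `𝒰`. -/
def boundaryDeriv : CVec m n → ℂ × (Fin m → ℂ) := extendFrom (interiorU m n) X.interiorDeriv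

theorem continuousOn_boundaryDeriv (hA : X.IsAffine) (hS : X.IsStochContinuous)
    (hH : X.IsSemiHomogeneous) : ContinuousOn X.boundaryDeriv (cU m n) :=
  continuousOn_extendFrom
    (fun _ hu => mem_closure_iff_nhdsWithin_neBot.2 (nhdsWithin_interiorU_neBot hu))
    fun _ hu => exists_tendsto_interiorDeriv hA hS hH hu

theorem boundaryDeriv_eq (hA : X.IsAffine) (hS : X.IsStochContinuous) (hH : X.IsSemiHomogeneous)
    {u : CVec m n} (hu : u ∈ interiorU m n) : X.boundaryDeriv u = X.interiorDeriv u :=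
  extendFrom_eq (subset_closure hu) (continuousOn_interiorDeriv hA hS hH u hu)

/-- The Riccati equations: the semiflow property moves the derivative at time 0, taken at ψ(s,u), to
time s. -/
theorem hasDerivWithinAt_curve_at (hA : X.IsAffine) (hS : X.IsStochContinuous)
    (hH : X.IsSemiHomogeneous) {u : CVec m n} {s : ℝ} (hs : 0 ≤ s)
    (hq : ∀ᶠ r in 𝓝[≥] s, (r.toNNReal, u) ∈ X.domQ)
    (hψ : X.psi (s.toNNReal, u) ∈ interiorU m n) :
    HasDerivWithinAt (X.curve u)
      (X.charFun 0 s.toNNReal u * (X.boundaryDeriv (X.psi (s.toNNReal, u))).1,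
        (X.boundaryDeriv (X.psi (s.toNNReal, u))).2) (Ici s) s := by
  have hqs : (s.toNNReal, u) ∈ X.domQ := hq.self_of_nhdsWithin self_mem_Ici
  rw [boundaryDeriv_eq hA hS hH hψ]
  have hd := hasDerivWithinAt_curve hA hS hH hψ
  have hshift : HasDerivWithinAt (fun r : ℝ => r - s) 1 (Ici s) s :=
    ((hasDerivAt_id s).sub_const s).hasDerivWithinAt
  have hmaps : MapsTo (fun r : ℝ => r - s) (Ici s) (Ici 0) := fun r hr => mem_Ici.2 (sub_nonneg.2 hr)
  have hd' := HasDerivWithinAt.scomp_of_eq s hd hshift hmaps (by simp)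
  rw [one_smul] at hd'
  have hd1 : HasDerivWithinAt (fun r => X.charFun 0 s.toNNReal u *
      (X.curve (X.psi (s.toNNReal, u)) (r - s)).1)
      (X.charFun 0 s.toNNReal u * (X.interiorDeriv (X.psi (s.toNNReal, u))).1) (Ici s) s :=
    HasDerivWithinAt.const_mul _ (d := fun r => (X.curve (X.psi (s.toNNReal, u)) (r - s)).1) hd'.fst
  have hd2 : HasDerivWithinAt (fun r => (X.curve (X.psi (s.toNNReal, u)) (r - s)).2)
      (X.interiorDeriv (X.psi (s.toNNReal, u))).2 (Ici s) s := hd'.snd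
  have key : ∀ r, s ≤ r → (r.toNNReal, u) ∈ X.domQ → X.curve u r =
      (X.charFun 0 s.toNNReal u * (X.curve (X.psi (s.toNNReal, u)) (r - s)).1,
        (X.curve (X.psi (s.toNNReal, u)) (r - s)).2) := by
    intro r hr hrq
    have e : r.toNNReal = s.toNNReal + (r - s).toNNReal := by
      rw [← Real.toNNReal_add hs (sub_nonneg.2 hr)]
      congr 1
      ring
    simp only [curve]
    rw [e] at hrq ⊢
    rw [charFun_zero_add hA hH hqs, psi_add hA hH hqs hrq]
  refine (hd1.prodMk hd2).congr_of_eventuallyEq ?_ (key s le_rfl hqs)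
  filter_upwards [hq, self_mem_nhdsWithin] with r hr hrs using key r hrs hr

/-- The semiflow argument is unavailable at u₀, which has no ball of 𝒰 around it. The derivative is
instead inherited from interior points through an error bound ηt that is uniform in u. -/
theorem hasDerivWithinAt_curve_boundary (hA : X.IsAffine) (hS : X.IsStochContinuous)
    (hH : X.IsSemiHomogeneous) {u₀ : CVec m n} (hu₀ : u₀ ∈ cU m n) :
    HasDerivWithinAt (X.curve u₀) (X.boundaryDeriv u₀) (Ici 0) 0 := by
  set B₀ := X.boundaryDeriv u₀ with hB₀
  set H : ℝ≥0 × CVec m n → ℂ × (Fin m → ℂ) := fun q =>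
    (X.charFun 0 q.1 q.2 * (X.boundaryDeriv (X.psi q)).1, (X.boundaryDeriv (X.psi q)).2) with hHdef
  have hQ0 := zero_mem_domQ (X := X) hu₀
  have hext := isAffineExtension_psi hA hS hH
  have hB : ContinuousOn (fun q => X.boundaryDeriv (X.psi q)) X.domQ :=
    (continuousOn_boundaryDeriv hA hS hH).comp hext.continuousOn_ψ
      fun q hq => psi_mem_cU hA hH hq
  have hHc : ContinuousOn H X.domQ :=
    (hext.continuousOn_Φ.mul (continuous_fst.comp_continuousOn hB)).prodMk
      (continuous_snd.comp_continuousOn hB)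
  have hH0 : H (0, u₀) = B₀ := by
    simp only [hHdef, psi_zero hA hH hu₀, X.charFun_zero, pairing_zero_left, Complex.exp_zero,
      one_mul]
    rfl
  have hYc : ContinuousOn (fun q : ℝ≥0 × CVec m n => (X.charFun 0 q.1 q.2, (X.psi q).1)) X.domQ :=
    hext.continuousOn_Φ.prodMk (continuous_fst.comp_continuousOn hext.continuousOn_ψ)
  have hbound : ∀ η > 0, ∀ᶠ t in 𝓝[≥] (0 : ℝ),
      ‖X.curve u₀ t - X.curve u₀ 0 - (t : ℝ) • B₀‖ ≤ η * t := by
    intro η hη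
    have h1 : ∀ᶠ q in 𝓝[{q : ℝ≥0 × CVec m n | q.2 ∈ cU m n}] (0, u₀),
        q ∈ X.domQ ∧ ‖H q - B₀‖ ≤ η := by
      have hQn := domQ_mem_nhdsWithin hS hQ0
      have h2 : ∀ᶠ q in 𝓝[X.domQ] (0, u₀), ‖H q - B₀‖ ≤ η := by
        have := (Metric.tendsto_nhds.1 (hHc _ hQ0).tendsto) η hη
        filter_upwards [this] with q hq
        rw [hH0, dist_eq_norm] at hq
        exact hq.le
      have h3 : ∀ᶠ q in 𝓝[{q : ℝ≥0 × CVec m n | q.2 ∈ cU m n}] (0, u₀), ‖H q - B₀‖ ≤ η :=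
        h2.filter_mono (nhdsWithin_le_iff.2 hQn)
      filter_upwards [hQn, h3] with q h4 h5 using ⟨h4, h5⟩
    rw [eventually_nhdsWithin_iff, nhds_prod_eq, eventually_prod_iff] at h1
    obtain ⟨pa, hpa, pb, hpb, hab⟩ := h1
    have h2 := tendsto_toNNReal_zero.eventually
      (hpa.and (eventually_psi_mem_interiorU hA hS hH))
    obtain ⟨δ, hδ, hδt⟩ := (mem_nhdsGE_iff_exists_Ico_subset' (zero_lt_one' ℝ)).1 h2
    have hδ0 : (0 : ℝ) < δ := hδ
    filter_upwards [Ico_mem_nhdsGE hδ0] with t ht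
    have hgood : ∀ u ∈ cU m n, pb u → ∀ r, 0 ≤ r → r < δ →
        (r.toNNReal, u) ∈ X.domQ ∧ ‖H (r.toNNReal, u) - B₀‖ ≤ η := fun u hu hpu r h0 hr =>
      hab (hδt ⟨h0, hr⟩).1 hpu hu
    have hcurve : ∀ u ∈ cU m n, pb u → ContinuousOn (X.curve u) (Icc 0 t) := by
      intro u hu hpu
      refine hYc.comp (f := fun r : ℝ => (r.toNNReal, u)) ?_ fun r hr =>
        (hgood u hu hpu r hr.1 (hr.2.trans_lt ht.2)).1
      exact (by fun_prop : Continuous fun r : ℝ => (r.toNNReal, u)).continuousOn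
    -- The orbit of an interior u stays interior up to time δ, so its right derivative is H, within
    -- η of B₀; the mean value inequality integrates this.
    have hint : ∀ u ∈ interiorU m n, pb u →
        ‖X.curve u t - X.curve u 0 - (t : ℝ) • B₀‖ ≤ η * t := by
      intro u hu hpu
      have hu' := interiorU_subset hu
      have hlin : ∀ r : ℝ, HasDerivAt (fun r : ℝ => r • B₀) B₀ r := fun r => by
        simpa using (hasDerivAt_id r).smul_const B₀
      have h3 := norm_image_sub_le_of_norm_deriv_right_le_segment
        (f := fun r => X.curve u r - r • B₀) (f' := fun r => H (r.toNNReal, u) - B₀) (C := η)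
        (a := 0) (b := t) ((hcurve u hu' hpu).sub (by fun_prop))
        (fun r hr => by
          have hrδ : r < δ := hr.2.trans ht.2
          refine HasDerivWithinAt.sub ?_ (hlin r).hasDerivWithinAt
          refine hasDerivWithinAt_curve_at hA hS hH hr.1 ?_
            ((hδt ⟨hr.1, hrδ⟩).2 u hu (hgood u hu' hpu r hr.1 hrδ).1)
          filter_upwards [Ico_mem_nhdsGE hrδ] with r' hr'
          exact (hgood u hu' hpu r' (hr.1.trans hr'.1) hr'.2).1)
        (fun r hr => (hgood u hu' hpu r hr.1 (hr.2.trans ht.2)).2) t ⟨ht.1, le_rfl⟩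
      simp only [zero_smul, sub_zero] at h3
      rwa [sub_right_comm] at h3
    have := nhdsWithin_interiorU_neBot hu₀
    have hpb0 : pb u₀ := hpb.self_of_nhds
    have hlim : ∀ r, 0 ≤ r → r < δ → Tendsto (fun u => X.curve u r) (𝓝[interiorU m n] u₀)
        (𝓝 (X.curve u₀ r)) := by
      intro r h0 hr
      refine (hYc _ (hgood u₀ hu₀ hpb0 r h0 hr).1).tendsto.comp
        (f := fun u : CVec m n => (r.toNNReal, u)) (tendsto_nhdsWithin_iff.2 ⟨?_, ?_⟩)
      · exact ((by fun_prop : Continuous fun u : CVec m n => (r.toNNReal, u)).tendsto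
          u₀).mono_left nhdsWithin_le_nhds
      · filter_upwards [self_mem_nhdsWithin, hpb.filter_mono nhdsWithin_le_nhds] with u hu hpu
        exact (hgood u (interiorU_subset hu) hpu r h0 hr).1
    -- At fixed t the bound passes to u₀ by continuity of the curve in u.
    refine le_of_tendsto (((hlim t ht.1 ht.2).sub (hlim 0 le_rfl hδ0)).sub_const _).norm ?_
    filter_upwards [self_mem_nhdsWithin, hpb.filter_mono nhdsWithin_le_nhds] with u hu hpu
    exact hint u hu hpu
  rw [hasDerivWithinAt_iff_isLittleO, Asymptotics.isLittleO_iff]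
  intro η hη
  filter_upwards [hbound η hη, self_mem_nhdsWithin] with t ht ht0
  rwa [sub_zero, Real.norm_of_nonneg ht0]

theorem isRegular (hA : X.IsAffine) (hS : X.IsStochContinuous) (hH : X.IsSemiHomogeneous) :
    X.IsRegular := by
  refine ⟨fun q => X.charFun 0 q.1 q.2, X.psi, isAffineExtension_psi hA hS hH,
    fun u => (X.boundaryDeriv u).1, fun u => ((X.boundaryDeriv u).2, 0),
    continuous_fst.comp_continuousOn (continuousOn_boundaryDeriv hA hS hH),
    (continuous_snd.comp_continuousOn (continuousOn_boundaryDeriv hA hS hH)).prodMk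
      continuousOn_const, fun u hu => ?_⟩
  have hd := hasDerivWithinAt_curve_boundary hA hS hH hu
  refine ⟨hd.fst, ?_⟩
  have h1 : HasDerivWithinAt (fun t : ℝ => ((X.psi (t.toNNReal, u)).1, u.2))
      ((X.boundaryDeriv u).2, 0) (Ici 0) 0 := hd.snd.prodMk (hasDerivWithinAt_const _ _ _)
  have hQ : ∀ᶠ t in 𝓝[≥] (0 : ℝ), (t.toNNReal, u) ∈ X.domQ :=
    tendsto_toNNReal_zero.eventually (eventually_mem_domQ hS hu)
  have key : ∀ t : ℝ, (t.toNNReal, u) ∈ X.domQ →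
      X.psi (t.toNNReal, u) = ((X.psi (t.toNNReal, u)).1, u.2) := fun t ht =>
    Prod.ext rfl (psi_snd hA hH ht)
  refine h1.congr_of_eventuallyEq ?_ (key 0 (hQ.self_of_nhdsWithin self_mem_Ici))
  filter_upwards [hQ] with t ht using key t ht

end MarkovProcess

end AffineProc

end

theorem mainTheorem3 {m n : ℕ} {Ω : Type*} [MeasurableSpace Ω]
    (X : AffineProc.MarkovProcess m n Ω) (hAffine : X.IsAffine)
    (hStoch : X.IsStochContinuous) (hSemi : X.IsSemiHomogeneous) :
    X.IsRegular :=
  AffineProc.MarkovProcess.isRegular hAffine hStoch hSemi
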